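/- Let $s\in(0,1)$, let $N\ge 1$ be an integer with $N>2s$, let $k\ge 1$ and $\lambda_1,\dots,\lambda_k\in\mathbb R$, and write $t^+:=\max\{0,t\}$. Put $$C(N,s)=\pi^{-\frac N2}\,2^{2s}\,\frac{\Gamma\left(\frac{N+2s}{2}\right)}{\Gamma(2-s)}\,s(1-s),\qquad \gamma_H=2^{2s}\,\frac{\Gamma^2\left(\frac{N+2s}{4}\right)}{\Gamma^2\left(\frac{N-2s}{4}\right)}.$$ Let $\mathcal D^{s,2}(\mathbb R^N)$ be the completion of $C_c^\infty(\mathbb R^N)$ (real-valued functions) with respect to the norm $$\|u\|^2=\frac{C(N,s)}2\int_{\mathbb R^{2N}}\frac{|u(x)-u(y)|^2}{|x-y|^{N+2s}}\,dx\,dy ,$$ regarded as a space of functions in $L^{2N/(N-2s)}(\mathbb R^N)$. For $a_1,\dots,a_k\in\mathbb R^N$ and $u\in\mathcal D^{s,2}(\mathbb R^N)$ let $$Q_{\lambda_1,\dots,\lambda_k,a_1,\dots,a_k}(u)=\|u\|^2-\sum_{i=1}^k\lambda_i\int_{\mathbb R^N}\frac{|u(x)|^2}{|x-a_i|^{2s}}\,dx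 ,$$ and call this quadratic form positive definite if $\inf_{u\in\mathcal D^{s,2}(\mathbb R^N)\setminus\{0\}} Q_{\lambda_1,\dots,\lambda_k,a_1,\dots,a_k}(u)/\|u\|^2>0$. If $\sum_{i=1}^k\lambda_i^+<\gamma_H$, then $Q_{\lambda_1,\dots,\lambda_k,a_1,\dots,a_k}$ is positive definite for all $a_1,\dots,a_k\in\mathbb R^N$. Conversely, if $\sum_{i=1}^k\lambda_i^+>\gamma_H$, then there exist pairwise distinct $a_1,\dots,a_k\in\mathbb R^N$ such that $Q_{\lambda_1,\dots,\lambda_k,a_1,\dots,a_k}$ is not positive definite. -/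

import Mathlib

open MeasureTheory Filter Topology
open scoped ENNReal

noncomputable section

namespace FracHardy

/-- The normalisation constant
`C(N,s) = π^(-N/2) 2^(2s) Γ((N+2s)/2) / Γ(2-s) * s (1-s)` of the fractional Laplacian. -/
def fracConst (N : ℕ) (s : ℝ) : ℝ :=
  Real.pi ^ (-(N : ℝ) / 2) * 2 ^ (2 * s) *
    (Real.Gamma (((N : ℝ) + 2 * s) / 2) / Real.Gamma (2 - s)) * (s * (1 - s))

/-- The Hardy constant `γ_H(N,s) = 2^(2s) Γ((N+2s)/4)^2 / Γ((N-2s)/4)^2`. -/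
def gammaH (N : ℕ) (s : ℝ) : ℝ :=
  2 ^ (2 * s) *
    (Real.Gamma (((N : ℝ) + 2 * s) / 4) ^ 2 / Real.Gamma (((N : ℝ) - 2 * s) / 4) ^ 2)

/-- The squared Gagliardo seminorm, with values in `[0,∞]`:
`(C(N,s)/2) ∬ |u(x)-u(y)|^2 / |x-y|^(N+2s) dx dy`. -/
def energy (N : ℕ) (s : ℝ) (u : EuclideanSpace ℝ (Fin N) → ℝ) : ℝ≥0∞ :=
  ENNReal.ofReal (fracConst N s / 2) *
    ∫⁻ z : EuclideanSpace ℝ (Fin N) × EuclideanSpace ℝ (Fin N),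
      ENNReal.ofReal ((u z.1 - u z.2) ^ 2 / ‖z.1 - z.2‖ ^ ((N : ℝ) + 2 * s))

/-- Smooth compactly supported real functions on `ℝ^N`. -/
def IsTestFunction (N : ℕ) (φ : EuclideanSpace ℝ (Fin N) → ℝ) : Prop :=
  ContDiff ℝ ((⊤ : ℕ∞) : WithTop ℕ∞) φ ∧ HasCompactSupport φ

/-- The critical Sobolev exponent `2N/(N-2s)`. -/
def critExp (N : ℕ) (s : ℝ) : ℝ≥0∞ :=
  ENNReal.ofReal (2 * (N : ℝ) / ((N : ℝ) - 2 * s))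

/-- The homogeneous fractional Sobolev space `D^{s,2}(ℝ^N)` (for `0 < s < 1`, `2s < N`): the
completion of the test functions for the Gagliardo norm, realised as usual as a space of
functions in `L^{2N/(N-2s)}`: those `u` which are the limit, both in the Gagliardo norm and in
`L^{2N/(N-2s)}`, of a sequence of test functions. Functions equal almost everywhere represent
the same element. -/
def Ds (N : ℕ) (s : ℝ) : Set (EuclideanSpace ℝ (Fin N) → ℝ) :=
  {u | MemLp u (critExp N s) volume ∧
    ∃ φ : ℕ → EuclideanSpace ℝ (Fin N) → ℝ, (∀ n, IsTestFunction N (φ n)) ∧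
      Tendsto (fun n => energy N s (φ n - u)) atTop (𝓝 0) ∧
      Tendsto (fun n => eLpNorm (φ n - u) (critExp N s) volume) atTop (𝓝 0)}

/-- The squared norm of `D^{s,2}(ℝ^N)` (the energy is finite for every `u` in `Ds N s`). -/
def normSq (N : ℕ) (s : ℝ) (u : EuclideanSpace ℝ (Fin N) → ℝ) : ℝ :=
  (energy N s u).toReal

/-- The quadratic form
`Q(u) = ‖u‖^2 - ∑ i, lam i * ∫ |u(x)|^2 / |x - a i|^(2s) dx`. -/
def Q (N : ℕ) (s : ℝ) {k : ℕ} (lam : Fin k → ℝ) (a : Fin k → EuclideanSpace ℝ (Fin N))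
    (u : EuclideanSpace ℝ (Fin N) → ℝ) : ℝ :=
  normSq N s u - ∑ i, lam i * ∫ x, (u x) ^ 2 / ‖x - a i‖ ^ (2 * s)

/-- `Q` is positive definite: the infimum of `Q(u) / ‖u‖^2` over the nonzero `u` in
`D^{s,2}(ℝ^N)` is positive. (A real `sInf` is `0` if the set is empty or unbounded below, so
`0 < sInf S` does say that `S` is nonempty with positive infimum.) -/
def IsPosDef (N : ℕ) (s : ℝ) {k : ℕ} (lam : Fin k → ℝ)
    (a : Fin k → EuclideanSpace ℝ (Fin N)) : Prop :=
  0 < sInf {t : ℝ | ∃ u ∈ Ds N s, ¬ (u =ᵐ[volume] 0) ∧ t = Q N s lam a u / normSq N s u}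

end FracHardy

end

noncomputable section

namespace FracHardy

open Set Real

/-! ### Gamma-type integrals over the half-line -/

theorem lintegral_ofReal_const_mul {α : Type*} [MeasurableSpace α] {μ : Measure α} {c : ℝ}
    (hc : 0 ≤ c) (f : α → ℝ) :
    ∫⁻ x, ENNReal.ofReal (c * f x) ∂μ = ENNReal.ofReal c * ∫⁻ x, ENNReal.ofReal (f x) ∂μ := by
  simp_rw [ENNReal.ofReal_mul hc]
  exact lintegral_const_mul' _ _ ENNReal.ofReal_ne_top

theorem lintegral_eq_of_iterated {α β : Type*} [MeasurableSpace α] [MeasurableSpace β]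
    {μ : Measure α} {ν : Measure β} [SFinite μ] [SFinite ν] (F : α → β → ℝ≥0∞)
    {A : α → ℝ≥0∞} {B : β → ℝ≥0∞} (hF : Measurable (Function.uncurry F))
    (hA : ∀ᵐ x ∂μ, ∫⁻ y, F x y ∂ν = A x) (hB : ∀ᵐ y ∂ν, ∫⁻ x, F x y ∂μ = B y) :
    ∫⁻ x, A x ∂μ = ∫⁻ y, B y ∂ν := by
  rw [← lintegral_congr_ae hA, ← lintegral_congr_ae hB]
  exact lintegral_lintegral_swap hF.aemeasurable

theorem ae_Ioi {p : ℝ → Prop} (h : ∀ x, 0 < x → p x) : ∀ᵐ x ∂volume.restrict (Ioi (0 : ℝ)), p x :=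
  ae_restrict_of_forall_mem measurableSet_Ioi h

theorem lintegral_rpow_mul_exp {p c : ℝ} (hp : 0 < p) (hc : 0 < c) :
    ∫⁻ t in Ioi (0 : ℝ), ENNReal.ofReal (t ^ (p - 1) * exp (-(c * t))) =
      ENNReal.ofReal (Gamma p * c ^ (-p)) := by
  have h := Real.integral_rpow_mul_exp_neg_mul_Ioi hp hc
  have hpos : 0 < (1 / c) ^ p * Gamma p := mul_pos (by positivity) (Gamma_pos_of_pos hp)
  rw [← ofReal_integral_eq_lintegral_ofReal, h]
  · rw [one_div, inv_rpow hc.le, rpow_neg hc.le, mul_comm]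
  · exact Integrable.of_integral_ne_zero (h ▸ hpos.ne')
  · exact ae_Ioi fun t ht => by dsimp; positivity

/-- Euler's integral, normalised so as to represent a negative power. -/
theorem lintegral_rpow_mul_exp_div {p c : ℝ} (hp : 0 < p) (hc : 0 < c) :
    ∫⁻ t in Ioi (0 : ℝ), ENNReal.ofReal ((Gamma p)⁻¹ * (t ^ (p - 1) * exp (-(c * t)))) =
      ENNReal.ofReal (c ^ (-p)) := by
  have := Gamma_pos_of_pos hp
  rw [lintegral_ofReal_const_mul (by positivity), lintegral_rpow_mul_exp hp hc,
    ← ENNReal.ofReal_mul (by positivity)]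
  congr 1
  field_simp

theorem lintegral_rpow_Ioc {s t : ℝ} (hs : 0 < s) (ht : 0 < t) :
    ∫⁻ θ in Ioc 0 t, ENNReal.ofReal (θ ^ (s - 1)) = ENNReal.ofReal (t ^ s / s) := by
  have hint : IntervalIntegrable (fun θ : ℝ => θ ^ (s - 1)) volume 0 t :=
    intervalIntegral.intervalIntegrable_rpow' (by linarith)
  rw [← ofReal_integral_eq_lintegral_ofReal, ← intervalIntegral.integral_of_le ht.le,
    integral_rpow (Or.inl (by linarith))]
  · rw [sub_add_cancel, zero_rpow hs.ne', sub_zero]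
  · exact (intervalIntegrable_iff_integrableOn_Ioc_of_le ht.le).1 hint
  · refine ae_restrict_of_forall_mem measurableSet_Ioc fun θ hθ => ?_
    exact rpow_nonneg hθ.1.le _

theorem lintegral_exp_Ioc {σ t : ℝ} (hσ : 0 < σ) (ht : 0 < t) :
    ∫⁻ θ in Ioc 0 t, ENNReal.ofReal (σ * exp (-(σ * θ))) =
      ENNReal.ofReal (1 - exp (-(σ * t))) := by
  have hd : ∀ θ ∈ uIcc 0 t,
      HasDerivAt (fun θ => -exp (-(σ * θ))) (σ * exp (-(σ * θ))) θ := fun θ _ => by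
    have h1 : HasDerivAt (fun θ => -(σ * θ)) (-(σ * 1)) θ := ((hasDerivAt_id θ).const_mul σ).neg
    exact h1.exp.neg.congr_deriv (by ring)
  have hc : Continuous fun θ : ℝ => σ * exp (-(σ * θ)) := by fun_prop
  rw [← ofReal_integral_eq_lintegral_ofReal, ← intervalIntegral.integral_of_le ht.le,
    intervalIntegral.integral_eq_sub_of_hasDerivAt hd (hc.intervalIntegrable _ _)]
  · congr 1
    simp
    ring
  · exact (intervalIntegrable_iff_integrableOn_Ioc_of_le ht.le).1 (hc.intervalIntegrable _ _)
  · exact ae_of_all _ fun θ => by dsimp; positivity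

theorem lintegral_rpow_mul_one_sub_exp {s t : ℝ} (hs0 : 0 < s) (hs1 : s < 1) (ht : 0 < t) :
    ∫⁻ σ in Ioi (0 : ℝ), ENNReal.ofReal (σ ^ (-s - 1) * (1 - exp (-(σ * t)))) =
      ENNReal.ofReal (Gamma (1 - s) / s * t ^ s) := by
  have hG := Gamma_pos_of_pos (show 0 < 1 - s by linarith)
  rw [lintegral_eq_of_iterated (ν := volume.restrict (Ioc 0 t))
    (B := fun θ => ENNReal.ofReal (Gamma (1 - s) * θ ^ (s - 1)))
    (fun σ θ => ENNReal.ofReal (σ ^ (-s - 1) * (σ * exp (-(σ * θ))))) (by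
      unfold Function.uncurry; fun_prop)]
  · rw [lintegral_ofReal_const_mul hG.le, lintegral_rpow_Ioc hs0 ht,
      ← ENNReal.ofReal_mul hG.le]
    congr 1
    ring
  · refine ae_Ioi fun σ hσ => ?_
    rw [lintegral_ofReal_const_mul (by positivity), lintegral_exp_Ioc hσ ht,
      ← ENNReal.ofReal_mul (by positivity)]
  · refine ae_restrict_of_forall_mem measurableSet_Ioc fun θ hθ => ?_
    have := lintegral_rpow_mul_exp (show 0 < 1 - s by linarith) hθ.1
    rw [neg_sub] at this
    rw [← this]
    refine setLIntegral_congr_fun measurableSet_Ioi fun σ (hσ : 0 < σ) => ?_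
    rw [← mul_assoc, ← rpow_add_one hσ.ne', mul_comm σ θ]
    ring_nf

/-- The constant `Γ(1-s) Γ(c+s) / (s Γ(c))`. -/
def powGap (s c : ℝ) : ℝ := Gamma (1 - s) * Gamma (c + s) / (s * Gamma c)

theorem powGap_pos {s c : ℝ} (hs0 : 0 < s) (hs1 : s < 1) (hc : 0 < c) : 0 < powGap s c := by
  have h1 := Gamma_pos_of_pos (show 0 < 1 - s by linarith)
  have h2 := Gamma_pos_of_pos (show 0 < c + s by linarith)
  have h3 := Gamma_pos_of_pos hc
  unfold powGap
  positivity

theorem lintegral_one_sub_rpow_div {s t c : ℝ} (hs0 : 0 < s) (hs1 : s < 1) (ht : 0 < t)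
    (hc : 0 < c) :
    ∫⁻ κ in Ioi (0 : ℝ), ENNReal.ofReal (κ ^ (s - 1) * (1 - (κ / (κ + t)) ^ c)) =
      ENNReal.ofReal (powGap s c * t ^ s) := by
  have hGc := Gamma_pos_of_pos hc
  have hGs := Gamma_pos_of_pos (show 0 < c + s by linarith)
  have hG1 := Gamma_pos_of_pos (show 0 < 1 - s by linarith)
  rw [lintegral_eq_of_iterated (ν := volume.restrict (Ioi 0))
    (B := fun σ => ENNReal.ofReal (Gamma (c + s) / Gamma c *
      (σ ^ (-s - 1) * (1 - exp (-(σ * t))))))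
    (fun κ σ => ENNReal.ofReal (κ ^ (s + c - 1) *
      ((Gamma c)⁻¹ * (σ ^ (c - 1) * (exp (-(σ * κ)) * (1 - exp (-(σ * t)))))))) (by
      unfold Function.uncurry; fun_prop)]
  · rw [lintegral_ofReal_const_mul (by positivity), lintegral_rpow_mul_one_sub_exp hs0 hs1 ht,
      ← ENNReal.ofReal_mul (by positivity)]
    congr 1
    unfold powGap
    field_simp
  · refine ae_Ioi fun κ hκ => ?_
    rw [lintegral_ofReal_const_mul (by positivity)]
    have h1 := lintegral_rpow_mul_exp_div hc hκ
    have h2 := lintegral_rpow_mul_exp_div hc (show 0 < κ + t by linarith)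
    have h3 : ∫⁻ σ in Ioi (0 : ℝ), ENNReal.ofReal ((Gamma c)⁻¹ * (σ ^ (c - 1) *
        (exp (-(σ * κ)) * (1 - exp (-(σ * t)))))) =
        ENNReal.ofReal (κ ^ (-c)) - ENNReal.ofReal ((κ + t) ^ (-c)) := by
      rw [← h1, ← h2, ← lintegral_sub (by fun_prop) (by rw [h2]; exact ENNReal.ofReal_ne_top)]
      · refine setLIntegral_congr_fun measurableSet_Ioi fun σ (hσ : 0 < σ) => ?_
        rw [← ENNReal.ofReal_sub _ (by positivity)]
        congr 1
        rw [add_mul, neg_add, exp_add, mul_comm σ κ, mul_comm σ t]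
        ring
      · refine ae_Ioi fun σ hσ => ENNReal.ofReal_le_ofReal ?_
        gcongr
        linarith
    rw [h3, ← ENNReal.ofReal_sub _ (by positivity), ← ENNReal.ofReal_mul (by positivity)]
    congr 1
    rw [div_rpow hκ.le (by positivity), rpow_neg hκ.le, rpow_neg (by positivity),
      show s + c - 1 = (s - 1) + c by ring, rpow_add hκ]
    field_simp
  · refine ae_Ioi fun σ hσ => ?_
    have h1 : 0 ≤ 1 - exp (-(σ * t)) := by
      rw [sub_nonneg, exp_le_one_iff]; nlinarith
    have h2 := lintegral_rpow_mul_exp (show 0 < s + c by linarith) hσ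
    calc _ = ∫⁻ κ in Ioi (0 : ℝ), ENNReal.ofReal (((Gamma c)⁻¹ * (σ ^ (c - 1) *
            (1 - exp (-(σ * t))))) * (κ ^ (s + c - 1) * exp (-(σ * κ)))) := by
          refine lintegral_congr fun κ => ?_
          congr 1; ring
      _ = _ := by
        rw [lintegral_ofReal_const_mul (by positivity), h2, ← ENNReal.ofReal_mul (by positivity)]
        congr 1
        rw [show -s - 1 = (c - 1) + -(s + c) by ring, rpow_add hσ, add_comm c s]
        ring

/-- Euler's beta integral of the second kind. -/
theorem lintegral_rpow_mul_one_add_rpow {p q : ℝ} (hp : 0 < p) (hq : 0 < q) :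
    ∫⁻ ρ in Ioi (0 : ℝ), ENNReal.ofReal (ρ ^ (p - 1) * (1 + ρ) ^ (-(p + q))) =
      ENNReal.ofReal (Gamma p * Gamma q / Gamma (p + q)) := by
  have hGp := Gamma_pos_of_pos hp
  have hGq := Gamma_pos_of_pos hq
  have hG := Gamma_pos_of_pos (add_pos hp hq)
  rw [lintegral_eq_of_iterated (ν := volume.restrict (Ioi 0))
    (B := fun σ => ENNReal.ofReal ((Gamma (p + q))⁻¹ * Gamma p *
      (σ ^ (q - 1) * exp (-(1 * σ)))))
    (fun ρ σ => ENNReal.ofReal (ρ ^ (p - 1) *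
      ((Gamma (p + q))⁻¹ * (σ ^ (p + q - 1) * exp (-((1 + ρ) * σ)))))) (by
      unfold Function.uncurry; fun_prop)]
  · rw [lintegral_ofReal_const_mul (by positivity), lintegral_rpow_mul_exp hq one_pos,
      ← ENNReal.ofReal_mul (by positivity), one_rpow]
    congr 1
    field_simp
  · refine ae_Ioi fun ρ hρ => ?_
    rw [lintegral_ofReal_const_mul (by positivity),
      lintegral_rpow_mul_exp_div (by linarith) (by linarith), ← ENNReal.ofReal_mul (by positivity)]
  · refine ae_Ioi fun σ hσ => ?_
    calc _ = ∫⁻ ρ in Ioi (0 : ℝ), ENNReal.ofReal (((Gamma (p + q))⁻¹ * (σ ^ (p + q - 1) *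
            exp (-(1 * σ)))) * (ρ ^ (p - 1) * exp (-(σ * ρ)))) := by
          refine lintegral_congr fun ρ => ?_
          rw [add_mul, neg_add, exp_add, mul_comm ρ σ]
          congr 1; ring
      _ = _ := by
        rw [lintegral_ofReal_const_mul (by positivity), lintegral_rpow_mul_exp hp hσ,
          ← ENNReal.ofReal_mul (by positivity)]
        congr 1
        rw [show p + q - 1 = (q - 1) + p by ring, rpow_add hσ, rpow_neg hσ.le]
        have := (rpow_pos_of_pos hσ p).ne'
        field_simp

/-! ### Gaussian integrals -/

theorem lintegral_gaussian (N : ℕ) {c : ℝ} (hc : 0 < c) :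
    ∫⁻ x : EuclideanSpace ℝ (Fin N), ENNReal.ofReal (exp (-(c * ‖x‖ ^ 2))) =
      ENNReal.ofReal ((π / c) ^ ((N : ℝ) / 2)) := by
  have h := GaussianFourier.integral_rexp_neg_mul_sq_norm (V := EuclideanSpace ℝ (Fin N)) hc
  rw [finrank_euclideanSpace_fin] at h
  have hpos : 0 < (π / c) ^ ((N : ℝ) / 2) := by positivity
  simp_rw [neg_mul] at h
  rw [← ofReal_integral_eq_lintegral_ofReal, h]
  · exact Integrable.of_integral_ne_zero (h ▸ hpos.ne')
  · exact ae_of_all _ fun x => by dsimp; positivity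

theorem sq_norm_combination {V : Type*} [NormedAddCommGroup V] [InnerProductSpace ℝ V]
    {c d : ℝ} (h : c + d ≠ 0) (x y : V) :
    c * ‖x - y‖ ^ 2 + d * ‖y‖ ^ 2 =
      (c + d) * ‖y - (c / (c + d)) • x‖ ^ 2 + c * d / (c + d) * ‖x‖ ^ 2 := by
  rw [norm_sub_sq_real, norm_sub_sq_real, inner_smul_right, norm_smul, mul_pow, norm_eq_abs,
    sq_abs, real_inner_comm]
  field_simp
  ring

theorem lintegral_gaussian_conv (N : ℕ) {c d : ℝ} (hc : 0 < c) (hd : 0 < d)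
    (x : EuclideanSpace ℝ (Fin N)) :
    ∫⁻ y : EuclideanSpace ℝ (Fin N),
        ENNReal.ofReal (exp (-(c * ‖x - y‖ ^ 2)) * exp (-(d * ‖y‖ ^ 2))) =
      ENNReal.ofReal ((π / (c + d)) ^ ((N : ℝ) / 2) * exp (-(c * d / (c + d) * ‖x‖ ^ 2))) := by
  have hcd : 0 < c + d := by linarith
  simp_rw [← exp_add, ← neg_add, sq_norm_combination hcd.ne', neg_add, exp_add]
  simp_rw [mul_comm (exp (-((c + d) * _)))]
  rw [lintegral_ofReal_const_mul (by positivity),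
    lintegral_sub_right_eq_self (fun y => ENNReal.ofReal (exp (-((c + d) * ‖y‖ ^ 2)))),
    lintegral_gaussian N hcd, ← ENNReal.ofReal_mul (by positivity), mul_comm]

theorem lintegral_gaussian_sub (N : ℕ) {c : ℝ} (hc : 0 < c) (x : EuclideanSpace ℝ (Fin N)) :
    ∫⁻ y : EuclideanSpace ℝ (Fin N), ENNReal.ofReal (exp (-(c * ‖x - y‖ ^ 2))) =
      ENNReal.ofReal ((π / c) ^ ((N : ℝ) / 2)) := by
  simp_rw [norm_sub_rev x]
  rw [lintegral_sub_right_eq_self (fun y => ENNReal.ofReal (exp (-(c * ‖y‖ ^ 2)))),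
    lintegral_gaussian N hc]

/-! ### Superposition of Gaussians for the Gagliardo kernel -/

/-- The space `ℝ^N`. -/
abbrev Eucl (N : ℕ) := EuclideanSpace ℝ (Fin N)

theorem lintegral_Ioi_eq_mul_comp {t : ℝ} (ht : 0 < t) {f : ℝ → ℝ≥0∞} (hf : Measurable f) :
    ∫⁻ κ in Ioi (0 : ℝ), f κ = ENNReal.ofReal t * ∫⁻ κ in Ioi (0 : ℝ), f (t * κ) := by
  rw [← lintegral_indicator measurableSet_Ioi, ← lintegral_indicator measurableSet_Ioi]
  conv_lhs => rw [← Real.smul_map_volume_mul_left ht.ne']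
  rw [lintegral_smul_measure, abs_of_pos ht,
    lintegral_map (hf.indicator measurableSet_Ioi) (by fun_prop), smul_eq_mul]
  congr 1
  refine lintegral_congr fun κ => ?_
  by_cases h : 0 < κ
  · rw [indicator_of_mem (show κ ∈ Ioi (0 : ℝ) from h),
      indicator_of_mem (show t * κ ∈ Ioi (0 : ℝ) from mul_pos ht h)]
  · rw [indicator_of_notMem (show κ ∉ Ioi (0 : ℝ) from h),
      indicator_of_notMem (show t * κ ∉ Ioi (0 : ℝ) from fun h' => h (pos_of_mul_pos_right h' ht.le))]

/-- Integral of `F` against a Gaussian of the difference. -/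
def gaussForm {N : ℕ} (F : Eucl N × Eucl N → ℝ≥0∞) (κ : ℝ) : ℝ≥0∞ :=
  ∫⁻ z : Eucl N × Eucl N, F z * ENNReal.ofReal (exp (-(κ * ‖z.1 - z.2‖ ^ 2)))

/-- Superposition of the Gaussian forms reproducing the kernel `|x-y|^(-N-2s)` up to a factor. -/
def heatForm (N : ℕ) (s : ℝ) (F : Eucl N × Eucl N → ℝ≥0∞) : ℝ≥0∞ :=
  ∫⁻ κ in Ioi (0 : ℝ), ENNReal.ofReal (κ ^ ((N : ℝ) / 2 + s - 1)) * gaussForm F κ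

theorem lintegral_kernel {N : ℕ} {s : ℝ} (hs : 0 < s) {F : Eucl N × Eucl N → ℝ≥0∞}
    (hF : Measurable F) (hdiag : ∀ x, F (x, x) = 0) :
    ∫⁻ z, F z * ENNReal.ofReal (1 / ‖z.1 - z.2‖ ^ ((N : ℝ) + 2 * s)) =
      ENNReal.ofReal (Gamma ((N : ℝ) / 2 + s))⁻¹ * heatForm N s F := by
  have hp : 0 < (N : ℝ) / 2 + s := by positivity
  have hG := Gamma_pos_of_pos hp
  unfold heatForm
  rw [← lintegral_const_mul' _ _ ENNReal.ofReal_ne_top]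
  refine lintegral_eq_of_iterated (ν := volume.restrict (Ioi 0))
    (fun z κ => F z * ENNReal.ofReal ((Gamma ((N : ℝ) / 2 + s))⁻¹ *
      (κ ^ ((N : ℝ) / 2 + s - 1) * exp (-(‖z.1 - z.2‖ ^ 2 * κ))))) ?_ ?_ ?_
  · unfold Function.uncurry
    fun_prop
  · refine ae_of_all _ fun z => ?_
    by_cases hz : z.1 = z.2
    · have : F z = 0 := by
        have := hdiag z.1
        rwa [show (z.1, z.1) = z from Prod.ext rfl hz] at this
      simp [this]
    · have hz' : 0 < ‖z.1 - z.2‖ := norm_pos_iff.2 (sub_ne_zero.2 hz)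
      rw [lintegral_const_mul _ (by fun_prop), lintegral_rpow_mul_exp_div hp (by positivity),
        ← rpow_natCast, ← rpow_mul hz'.le, one_div, ← rpow_neg hz'.le]
      congr 3
      push_cast
      ring
  · refine ae_Ioi fun κ hκ => ?_
    unfold gaussForm
    rw [← lintegral_const_mul' _ _ ENNReal.ofReal_ne_top,
      ← lintegral_const_mul' _ _ ENNReal.ofReal_ne_top]
    refine lintegral_congr fun z => ?_
    rw [ENNReal.ofReal_mul (by positivity), ENNReal.ofReal_mul (by positivity), mul_comm κ]
    ring

theorem energy_eq_heatForm {N : ℕ} {s : ℝ} (hs : 0 < s) {u : Eucl N → ℝ} (hu : Measurable u) :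
    energy N s u = ENNReal.ofReal (fracConst N s / 2) *
      (ENNReal.ofReal (Gamma ((N : ℝ) / 2 + s))⁻¹ *
        heatForm N s fun z => ENNReal.ofReal ((u z.1 - u z.2) ^ 2)) := by
  rw [← lintegral_kernel hs (by fun_prop) (by simp)]
  unfold energy
  congr 1
  refine lintegral_congr fun z => ?_
  rw [← ENNReal.ofReal_mul (by positivity), mul_one_div]

/-! ### The Hardy inequality for square integrable functions -/

/-- Average against the weights which represent `‖x‖^(-2a)` as a superposition of Gaussians. -/
def poleAvg {N : ℕ} (a : ℝ) (x : Eucl N) (f : ℝ → ℝ) : ℝ≥0∞ :=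
  ∫⁻ τ in Ioi (0 : ℝ), ENNReal.ofReal (‖x‖ ^ (2 * a) * ((Gamma a)⁻¹ * τ ^ (a - 1)) * f τ)

theorem poleAvg_add {N : ℕ} {a : ℝ} (ha : 0 < a) (x : Eucl N) {f g : ℝ → ℝ}
    (hf : ∀ τ, 0 < τ → 0 ≤ f τ) (hg : ∀ τ, 0 < τ → 0 ≤ g τ) (hfm : Measurable f) :
    poleAvg a x (fun τ => f τ + g τ) = poleAvg a x f + poleAvg a x g := by
  have := Gamma_pos_of_pos ha
  unfold poleAvg
  rw [← lintegral_add_left (by fun_prop)]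
  refine setLIntegral_congr_fun measurableSet_Ioi fun τ (hτ : 0 < τ) => ?_
  have h1 := hf τ hτ
  have h2 := hg τ hτ
  dsimp only
  rw [← ENNReal.ofReal_add (by positivity) (by positivity), mul_add]

theorem measurable_poleAvg {N : ℕ} (a : ℝ) {f : Eucl N → ℝ → ℝ}
    (hf : Measurable (Function.uncurry f)) : Measurable fun x => poleAvg a x (f x) := by
  unfold poleAvg
  refine Measurable.lintegral_prod_right' (f := fun p : Eucl N × ℝ =>
    ENNReal.ofReal (‖p.1‖ ^ (2 * a) * ((Gamma a)⁻¹ * p.2 ^ (a - 1)) * f p.1 p.2)) ?_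
  have : Measurable fun p : Eucl N × ℝ => f p.1 p.2 := hf
  fun_prop

theorem norm_rpow_two_mul {N : ℕ} (x : Eucl N) (a : ℝ) : (‖x‖ ^ 2) ^ a = ‖x‖ ^ (2 * a) := by
  rw [← rpow_natCast, ← rpow_mul (norm_nonneg _)]
  norm_num

theorem poleAvg_const_mul_exp {N : ℕ} {a : ℝ} (ha : 0 < a) {x : Eucl N} (hx : x ≠ 0) {c : ℝ}
    (hc : 0 ≤ c) : poleAvg a x (fun τ => c * exp (-(τ * ‖x‖ ^ 2))) = ENNReal.ofReal c := by
  have hx' : 0 < ‖x‖ := norm_pos_iff.2 hx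
  have := Gamma_pos_of_pos ha
  unfold poleAvg
  calc _ = ∫⁻ τ in Ioi (0 : ℝ), ENNReal.ofReal ((‖x‖ ^ (2 * a) * c) *
        ((Gamma a)⁻¹ * (τ ^ (a - 1) * exp (-(‖x‖ ^ 2 * τ))))) := by
        refine lintegral_congr fun τ => ?_
        dsimp only
        rw [mul_comm τ]
        congr 1
        ring
    _ = _ := by
        rw [lintegral_ofReal_const_mul (by positivity),
          lintegral_rpow_mul_exp_div ha (by positivity), ← ENNReal.ofReal_mul (by positivity),
          rpow_neg (by positivity), norm_rpow_two_mul]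
        congr 1
        field_simp

/-- The action of the Gaussian kernel on `‖·‖^(-2a)`. -/
theorem lintegral_pole_gaussian {N : ℕ} {a κ : ℝ} (ha : 0 < a) (hκ : 0 < κ)
    (hN : 0 < N) (x : Eucl N) :
    ∫⁻ y : Eucl N, ENNReal.ofReal
        (‖x‖ ^ (2 * a) * ‖y‖ ^ (-(2 * a)) * exp (-(κ * ‖x - y‖ ^ 2))) =
      poleAvg a x (fun τ => (π / (κ + τ)) ^ ((N : ℝ) / 2) *
        exp (-(κ * τ / (κ + τ) * ‖x‖ ^ 2))) := by
  have hG := Gamma_pos_of_pos ha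
  have : Nonempty (Fin N) := ⟨⟨0, hN⟩⟩
  unfold poleAvg
  refine lintegral_eq_of_iterated (ν := volume.restrict (Ioi 0))
    (fun y τ => ENNReal.ofReal (‖x‖ ^ (2 * a) * exp (-(κ * ‖x - y‖ ^ 2)) *
      ((Gamma a)⁻¹ * (τ ^ (a - 1) * exp (-(‖y‖ ^ 2 * τ)))))) ?_ ?_ ?_
  · unfold Function.uncurry
    fun_prop
  · have h0 : ∀ᵐ y : Eucl N, y ≠ 0 := by
      simp [ae_iff]
    filter_upwards [h0] with y hy
    have hy' : 0 < ‖y‖ := norm_pos_iff.2 hy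
    rw [lintegral_ofReal_const_mul (by positivity),
      lintegral_rpow_mul_exp_div ha (by positivity), ← ENNReal.ofReal_mul (by positivity),
      norm_rpow_two_mul]
    congr 1
    ring_nf
  · refine ae_Ioi fun τ hτ => ?_
    rw [ENNReal.ofReal_mul (by positivity), ← lintegral_gaussian_conv N hκ hτ x,
      ← lintegral_ofReal_const_mul (by positivity)]
    refine lintegral_congr fun y => ?_
    rw [mul_comm τ]
    congr 1
    ring

theorem ae_ne_zero {N : ℕ} (hN : 0 < N) : ∀ᵐ y : Eucl N, y ≠ 0 := by
  have : Nonempty (Fin N) := ⟨⟨0, hN⟩⟩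
  simp [ae_iff]

theorem sq_add_sq_le_picone {r : ℝ} (hr : 0 < r) (p q : ℝ) :
    p ^ 2 + q ^ 2 ≤ (p - q) ^ 2 + p ^ 2 * r + q ^ 2 * r⁻¹ := by
  have h : (p - q) ^ 2 + p ^ 2 * r + q ^ 2 * r⁻¹ - (p ^ 2 + q ^ 2) = (r * p - q) ^ 2 * r⁻¹ := by
    field_simp
    ring
  have : 0 ≤ (r * p - q) ^ 2 * r⁻¹ := by positivity
  linarith

theorem lintegral_prod_comm_symm {N : ℕ} (f : Eucl N × Eucl N → ℝ≥0∞) :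
    ∫⁻ z : Eucl N × Eucl N, f z.swap = ∫⁻ z, f z :=
  lintegral_prod_swap f

theorem gaussForm_lower_bound {N : ℕ} {a κ : ℝ} (ha : 0 < a) (hκ : 0 < κ) (hN : 0 < N)
    {φ : Eucl N → ℝ} (hφ : Measurable φ) :
    2 * ∫⁻ x, ENNReal.ofReal (φ x ^ 2) * ENNReal.ofReal ((π / κ) ^ ((N : ℝ) / 2)) ≤
      gaussForm (fun z => ENNReal.ofReal ((φ z.1 - φ z.2) ^ 2)) κ +
      2 * ∫⁻ x, ENNReal.ofReal (φ x ^ 2) *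
        poleAvg a x (fun τ => (π / (κ + τ)) ^ ((N : ℝ) / 2) *
          exp (-(κ * τ / (κ + τ) * ‖x‖ ^ 2))) := by
  let F : Eucl N × Eucl N → ℝ≥0∞ := fun z =>
    ENNReal.ofReal (φ z.1 ^ 2) * ENNReal.ofReal (exp (-(κ * ‖z.1 - z.2‖ ^ 2)))
  let G : Eucl N × Eucl N → ℝ≥0∞ := fun z =>
    ENNReal.ofReal (φ z.1 ^ 2) * ENNReal.ofReal
      (‖z.1‖ ^ (2 * a) * ‖z.2‖ ^ (-(2 * a)) * exp (-(κ * ‖z.1 - z.2‖ ^ 2)))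
  have hFm : Measurable F := by fun_prop
  have hGm : Measurable G := by fun_prop
  have hF : ∫⁻ z, F z =
      ∫⁻ x, ENNReal.ofReal (φ x ^ 2) * ENNReal.ofReal ((π / κ) ^ ((N : ℝ) / 2)) := by
    rw [Measure.volume_eq_prod, lintegral_prod _ hFm.aemeasurable]
    refine lintegral_congr fun x => ?_
    simp only [F]
    rw [lintegral_const_mul _ (by fun_prop), lintegral_gaussian_sub N hκ]
  have hG : ∫⁻ z, G z = ∫⁻ x, ENNReal.ofReal (φ x ^ 2) *
      poleAvg a x (fun τ => (π / (κ + τ)) ^ ((N : ℝ) / 2) *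
        exp (-(κ * τ / (κ + τ) * ‖x‖ ^ 2))) := by
    rw [Measure.volume_eq_prod, lintegral_prod _ hGm.aemeasurable]
    refine lintegral_congr fun x => ?_
    simp only [G]
    rw [lintegral_const_mul _ (by fun_prop), lintegral_pole_gaussian ha hκ hN]
  have h1 : ∀ᵐ z : Eucl N × Eucl N, z.1 ≠ 0 :=
    Measure.quasiMeasurePreserving_fst.ae (ae_ne_zero hN)
  have h2 : ∀ᵐ z : Eucl N × Eucl N, z.2 ≠ 0 :=
    Measure.quasiMeasurePreserving_snd.ae (ae_ne_zero hN)
  rw [← hF, ← hG, two_mul, two_mul]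
  nth_rewrite 2 [← lintegral_prod_comm_symm F]
  nth_rewrite 2 [← lintegral_prod_comm_symm G]
  unfold gaussForm
  rw [← lintegral_add_left hFm, ← lintegral_add_left hGm, ← lintegral_add_left (by fun_prop)]
  refine lintegral_mono_ae ?_
  filter_upwards [h1, h2] with z hz1 hz2
  have hz1' := norm_pos_iff.2 hz1
  have hz2' := norm_pos_iff.2 hz2
  have hr : 0 < ‖z.1‖ ^ (2 * a) * ‖z.2‖ ^ (-(2 * a)) := by positivity
  have key := sq_add_sq_le_picone hr (φ z.1) (φ z.2)
  have hinv : (‖z.1‖ ^ (2 * a) * ‖z.2‖ ^ (-(2 * a)))⁻¹ =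
      ‖z.2‖ ^ (2 * a) * ‖z.1‖ ^ (-(2 * a)) := by
    rw [rpow_neg hz1'.le, rpow_neg hz2'.le, mul_inv, inv_inv, mul_comm]
  rw [hinv] at key
  simp only [F, G, Prod.fst_swap, Prod.snd_swap]
  rw [norm_sub_rev z.2 z.1]
  simp only [← ENNReal.ofReal_mul (sq_nonneg _)]
  rw [← ENNReal.ofReal_add (by positivity) (by positivity),
    ← ENNReal.ofReal_add (by positivity) (by positivity),
    ← ENNReal.ofReal_add (by positivity) (by positivity)]
  refine ENNReal.ofReal_le_ofReal ?_
  have := mul_le_mul_of_nonneg_right key (exp_pos (-(κ * ‖z.1 - z.2‖ ^ 2))).le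
  linarith

theorem div_add_rpow_le {κ τ M : ℝ} (hκ : 0 < κ) (hτ : 0 < τ) (hM : 0 ≤ M) :
    (π / (κ + τ)) ^ M ≤ (π / κ) ^ M :=
  rpow_le_rpow (by positivity) (div_le_div_of_nonneg_left pi_pos.le hκ (by linarith)) hM

theorem exp_harmonic_le {κ τ r : ℝ} (hκ : 0 < κ) (hτ : 0 < τ) (hr : 0 ≤ r) :
    exp (-(τ * r)) ≤ exp (-(κ * τ / (κ + τ) * r)) := by
  refine exp_le_exp.2 (neg_le_neg (mul_le_mul_of_nonneg_right ?_ hr))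
  rw [div_le_iff₀ (by linarith)]
  nlinarith [mul_pos hκ hτ]

/-- Gaussian form of the Hardy inequality, with the part common to both sides removed. -/
theorem gaussForm_hardy {N : ℕ} {a κ : ℝ} (ha : 0 < a) (hκ : 0 < κ) (hN : 0 < N)
    {φ : Eucl N → ℝ} (hφ : Measurable φ) (hφ2 : ∫⁻ x, ENNReal.ofReal (φ x ^ 2) ≠ ∞) :
    2 * ∫⁻ x, ENNReal.ofReal (φ x ^ 2) * poleAvg a x (fun τ =>
        ((π / κ) ^ ((N : ℝ) / 2) - (π / (κ + τ)) ^ ((N : ℝ) / 2)) * exp (-(τ * ‖x‖ ^ 2))) ≤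
      gaussForm (fun z => ENNReal.ofReal ((φ z.1 - φ z.2) ^ 2)) κ +
      2 * ∫⁻ x, ENNReal.ofReal (φ x ^ 2) *
        poleAvg a x (fun τ => (π / (κ + τ)) ^ ((N : ℝ) / 2) *
          (exp (-(κ * τ / (κ + τ) * ‖x‖ ^ 2)) - exp (-(τ * ‖x‖ ^ 2)))) := by
  have hM : (0 : ℝ) ≤ (N : ℝ) / 2 := by positivity
  have hbound := gaussForm_lower_bound ha hκ hN hφ
  set C : Eucl N → ℝ≥0∞ := fun x => poleAvg a x (fun τ =>
    (π / (κ + τ)) ^ ((N : ℝ) / 2) * exp (-(τ * ‖x‖ ^ 2))) with hC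
  have hCm : Measurable C := measurable_poleAvg a (f := fun x τ =>
    (π / (κ + τ)) ^ ((N : ℝ) / 2) * exp (-(τ * ‖x‖ ^ 2))) (by unfold Function.uncurry; fun_prop)
  have hCmul : Measurable fun x => ENNReal.ofReal (φ x ^ 2) * C x := by fun_prop
  have hP : ∀ᵐ x : Eucl N, ENNReal.ofReal ((π / κ) ^ ((N : ℝ) / 2)) =
      C x + poleAvg a x (fun τ => ((π / κ) ^ ((N : ℝ) / 2) -
        (π / (κ + τ)) ^ ((N : ℝ) / 2)) * exp (-(τ * ‖x‖ ^ 2))) := by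
    filter_upwards [ae_ne_zero hN] with x hx
    rw [hC, ← poleAvg_add ha x (fun τ hτ => by positivity) (fun τ hτ => ?_) (by fun_prop)]
    · rw [← poleAvg_const_mul_exp ha hx (by positivity)]
      congr 1
      ext τ
      ring
    · exact mul_nonneg (sub_nonneg.2 (div_add_rpow_le hκ hτ hM)) (exp_pos _).le
  have hQ : ∀ x : Eucl N, poleAvg a x (fun τ => (π / (κ + τ)) ^ ((N : ℝ) / 2) *
        exp (-(κ * τ / (κ + τ) * ‖x‖ ^ 2))) =
      C x + poleAvg a x (fun τ => (π / (κ + τ)) ^ ((N : ℝ) / 2) *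
          (exp (-(κ * τ / (κ + τ) * ‖x‖ ^ 2)) - exp (-(τ * ‖x‖ ^ 2)))) := by
    intro x
    rw [hC, ← poleAvg_add ha x (fun τ hτ => by positivity) (fun τ hτ => ?_) (by fun_prop)]
    · congr 1
      ext τ
      ring
    · have := exp_harmonic_le hκ hτ (sq_nonneg ‖x‖)
      exact mul_nonneg (by positivity) (sub_nonneg.2 this)
  have hfin : 2 * ∫⁻ x, ENNReal.ofReal (φ x ^ 2) * C x ≠ ∞ := by
    refine ENNReal.mul_ne_top (by simp) (ne_top_of_le_ne_top (b := (∫⁻ x,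
      ENNReal.ofReal (φ x ^ 2)) * ENNReal.ofReal ((π / κ) ^ ((N : ℝ) / 2)))
      (ENNReal.mul_ne_top hφ2 ENNReal.ofReal_ne_top) ?_)
    rw [← lintegral_mul_const _ (by fun_prop)]
    refine lintegral_mono_ae ?_
    filter_upwards [hP] with x hx
    rw [hx]
    gcongr
    exact le_self_add
  have hP' : ∫⁻ x, ENNReal.ofReal (φ x ^ 2) * ENNReal.ofReal ((π / κ) ^ ((N : ℝ) / 2)) =
      (∫⁻ x, ENNReal.ofReal (φ x ^ 2) * C x) +
      ∫⁻ x, ENNReal.ofReal (φ x ^ 2) * poleAvg a x (fun τ =>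
        ((π / κ) ^ ((N : ℝ) / 2) - (π / (κ + τ)) ^ ((N : ℝ) / 2)) * exp (-(τ * ‖x‖ ^ 2))) := by
    rw [← lintegral_add_left hCmul]
    refine lintegral_congr_ae ?_
    filter_upwards [hP] with x hx
    rw [hx, mul_add]
  simp_rw [hP', hQ, mul_add] at hbound
  rw [lintegral_add_left hCmul, mul_add, ← add_assoc, add_comm (gaussForm _ _), add_assoc] at hbound
  exact (ENNReal.add_le_add_iff_left hfin).1 hbound

theorem rpow_mul_pi_div_sub {κ τ M s : ℝ} (hκ : 0 < κ) (hτ : 0 < τ) :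
    κ ^ (M + s - 1) * ((π / κ) ^ M - (π / (κ + τ)) ^ M) =
      π ^ M * (κ ^ (s - 1) * (1 - (κ / (κ + τ)) ^ M)) := by
  rw [div_rpow pi_pos.le hκ.le, div_rpow pi_pos.le (by positivity), div_rpow hκ.le (by positivity),
    show M + s - 1 = (s - 1) + M by ring, rpow_add hκ]
  have := (rpow_pos_of_pos hκ M).ne'
  field_simp

theorem lintegral_poleAvg_gap {N : ℕ} {a s M : ℝ} (ha : 0 < a) (hs0 : 0 < s) (hs1 : s < 1)
    (hM : 0 < M) {x : Eucl N} (hx : x ≠ 0) :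
    ∫⁻ κ in Ioi (0 : ℝ), ENNReal.ofReal (κ ^ (M + s - 1)) * poleAvg a x (fun τ =>
        ((π / κ) ^ M - (π / (κ + τ)) ^ M) * exp (-(τ * ‖x‖ ^ 2))) =
      ENNReal.ofReal (π ^ M * (Gamma (a + s) / Gamma a) * powGap s M) *
        ENNReal.ofReal (1 / ‖x‖ ^ (2 * s)) := by
  have hx' : 0 < ‖x‖ := norm_pos_iff.2 hx
  have hGa := Gamma_pos_of_pos ha
  have hGb := Gamma_pos_of_pos (show 0 < a + s by linarith)
  have hK := powGap_pos hs0 hs1 hM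
  rw [lintegral_eq_of_iterated (ν := volume.restrict (Ioi 0))
    (B := fun τ => ENNReal.ofReal ((‖x‖ ^ (2 * a) * (Gamma a)⁻¹ * π ^ M * powGap s M) *
      (τ ^ (a + s - 1) * exp (-(‖x‖ ^ 2 * τ)))))
    (fun κ τ => ENNReal.ofReal (κ ^ (M + s - 1)) * ENNReal.ofReal (‖x‖ ^ (2 * a) *
      ((Gamma a)⁻¹ * τ ^ (a - 1)) * (((π / κ) ^ M - (π / (κ + τ)) ^ M) *
        exp (-(τ * ‖x‖ ^ 2))))) (by unfold Function.uncurry; fun_prop)]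
  · rw [lintegral_ofReal_const_mul (by positivity),
      lintegral_rpow_mul_exp (by positivity) (by positivity), ← ENNReal.ofReal_mul (by positivity),
      ← ENNReal.ofReal_mul (by positivity), rpow_neg (by positivity), norm_rpow_two_mul, mul_add,
      rpow_add hx']
    congr 1
    field_simp
  · refine ae_Ioi fun κ hκ => ?_
    rw [lintegral_const_mul _ (by fun_prop)]
    rfl
  · refine ae_Ioi fun τ hτ => ?_
    calc _ = ∫⁻ κ in Ioi (0 : ℝ), ENNReal.ofReal ((‖x‖ ^ (2 * a) *
          ((Gamma a)⁻¹ * τ ^ (a - 1)) * exp (-(τ * ‖x‖ ^ 2)) * π ^ M) *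
          (κ ^ (s - 1) * (1 - (κ / (κ + τ)) ^ M))) := by
          refine setLIntegral_congr_fun measurableSet_Ioi fun κ (hκ : 0 < κ) => ?_
          rw [← ENNReal.ofReal_mul (by positivity)]
          congr 1
          rw [mul_assoc _ (π ^ M), ← rpow_mul_pi_div_sub hκ hτ]
          ring
      _ = _ := by
          rw [lintegral_ofReal_const_mul (by positivity),
            lintegral_one_sub_rpow_div hs0 hs1 hτ hM, ← ENNReal.ofReal_mul (by positivity),
            show a + s - 1 = (a - 1) + s by ring, rpow_add hτ, mul_comm τ (‖x‖ ^ 2)]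
          congr 1
          ring

theorem div_add_one_mem {κ : ℝ} (hκ : 0 < κ) : 0 < κ / (κ + 1) ∧ κ / (κ + 1) < 1 :=
  ⟨by positivity, by rw [div_lt_one (by positivity)]; linarith⟩

theorem lintegral_rpow_div_sub {a s M : ℝ} (ha : 0 < a) (hs0 : 0 < s) (hs1 : s < 1)
    (haM : a ≤ M) :
    ∫⁻ κ in Ioi (0 : ℝ), ENNReal.ofReal (κ ^ (s - 1) * ((κ / (κ + 1)) ^ a - (κ / (κ + 1)) ^ M)) =
      ENNReal.ofReal (powGap s M - powGap s a) := by
  have h1 := lintegral_one_sub_rpow_div hs0 hs1 one_pos ha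
  have h2 := lintegral_one_sub_rpow_div hs0 hs1 one_pos (ha.trans_le haM)
  rw [one_rpow, mul_one] at h1 h2
  rw [ENNReal.ofReal_sub _ (powGap_pos hs0 hs1 ha).le, ← h1, ← h2, ← lintegral_sub (by fun_prop)
    (by rw [h1]; exact ENNReal.ofReal_ne_top)]
  · refine setLIntegral_congr_fun measurableSet_Ioi fun κ (hκ : 0 < κ) => ?_
    obtain ⟨h3, h4⟩ := div_add_one_mem hκ
    rw [← ENNReal.ofReal_sub _ (mul_nonneg (by positivity)
      (sub_nonneg.2 (rpow_le_one h3.le h4.le ha.le)))]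
    congr 1
    ring
  · refine ae_Ioi fun κ hκ => ENNReal.ofReal_le_ofReal ?_
    obtain ⟨h3, h4⟩ := div_add_one_mem hκ
    have := rpow_le_rpow_of_exponent_ge h3 h4.le haM
    gcongr

theorem powGap_mono {s a M : ℝ} (ha : 0 < a) (hs0 : 0 < s) (hs1 : s < 1) (haM : a ≤ M) :
    powGap s a ≤ powGap s M := by
  have h1 := lintegral_one_sub_rpow_div hs0 hs1 one_pos ha
  have h2 := lintegral_one_sub_rpow_div hs0 hs1 one_pos (ha.trans_le haM)
  rw [one_rpow, mul_one] at h1 h2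
  rw [← ENNReal.ofReal_le_ofReal_iff (powGap_pos hs0 hs1 (ha.trans_le haM)).le, ← h1, ← h2]
  refine lintegral_mono_ae (ae_Ioi fun κ hκ => ENNReal.ofReal_le_ofReal ?_)
  obtain ⟨h3, h4⟩ := div_add_one_mem hκ
  have := rpow_le_rpow_of_exponent_ge h3 h4.le haM
  gcongr

theorem lintegral_rpow_mul_exp_sub {p c d : ℝ} (hp : 0 < p) (hc : 0 < c) (hcd : c ≤ d) :
    ∫⁻ t in Ioi (0 : ℝ), ENNReal.ofReal (t ^ (p - 1) * (exp (-(c * t)) - exp (-(d * t)))) =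
      ENNReal.ofReal (Gamma p * (c ^ (-p) - d ^ (-p))) := by
  have hG := Gamma_pos_of_pos hp
  have h1 := lintegral_rpow_mul_exp hp hc
  have h2 := lintegral_rpow_mul_exp hp (hc.trans_le hcd)
  rw [mul_sub, ENNReal.ofReal_sub _ (mul_nonneg hG.le (rpow_nonneg (hc.le.trans hcd) _)),
    ← h1, ← h2, ← lintegral_sub (by fun_prop) (by rw [h2]; exact ENNReal.ofReal_ne_top)]
  · refine setLIntegral_congr_fun measurableSet_Ioi fun t (ht : 0 < t) => ?_
    rw [← ENNReal.ofReal_sub _ (by positivity), mul_sub]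
  · exact ae_Ioi fun t ht => ENNReal.ofReal_le_ofReal (by gcongr)

theorem lintegral_poleAvg_excess {N : ℕ} {a s M : ℝ} (ha : 0 < a) (hs0 : 0 < s) (hs1 : s < 1)
    (hM : M = 2 * a + s) {x : Eucl N} (hx : x ≠ 0) :
    ∫⁻ κ in Ioi (0 : ℝ), ENNReal.ofReal (κ ^ (M + s - 1)) * poleAvg a x (fun τ =>
        (π / (κ + τ)) ^ M * (exp (-(κ * τ / (κ + τ) * ‖x‖ ^ 2)) - exp (-(τ * ‖x‖ ^ 2)))) =
      ENNReal.ofReal (π ^ M * (Gamma (a + s) / Gamma a) * (powGap s M - powGap s a)) *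
        ENNReal.ofReal (1 / ‖x‖ ^ (2 * s)) := by
  have hx' : 0 < ‖x‖ := norm_pos_iff.2 hx
  have hGa := Gamma_pos_of_pos ha
  have hGb := Gamma_pos_of_pos (show 0 < a + s by linarith)
  have haM : a ≤ M := by linarith
  have hK : 0 ≤ powGap s M - powGap s a := sub_nonneg.2 (powGap_mono ha hs0 hs1 haM)
  set D : ℝ := ‖x‖ ^ (2 * a) * (Gamma a)⁻¹ * π ^ M with hD
  have hDpos : 0 < D := by positivity
  have step1 : ∫⁻ κ in Ioi (0 : ℝ), ENNReal.ofReal (κ ^ (M + s - 1)) * poleAvg a x (fun τ =>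
        (π / (κ + τ)) ^ M * (exp (-(κ * τ / (κ + τ) * ‖x‖ ^ 2)) - exp (-(τ * ‖x‖ ^ 2)))) =
      ∫⁻ τ in Ioi (0 : ℝ), ∫⁻ κ in Ioi (0 : ℝ), ENNReal.ofReal (D *
        (κ ^ (s - 1) * (κ / (κ + 1)) ^ M) * (τ ^ (a + s - 1) *
          (exp (-(κ / (κ + 1) * ‖x‖ ^ 2 * τ)) - exp (-(‖x‖ ^ 2 * τ))))) := by
    refine lintegral_eq_of_iterated (ν := volume.restrict (Ioi 0))
      (fun κ τ => ENNReal.ofReal (κ ^ (M + s - 1)) * ENNReal.ofReal (‖x‖ ^ (2 * a) *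
        ((Gamma a)⁻¹ * τ ^ (a - 1)) * ((π / (κ + τ)) ^ M *
          (exp (-(κ * τ / (κ + τ) * ‖x‖ ^ 2)) - exp (-(τ * ‖x‖ ^ 2))))))
      (by unfold Function.uncurry; fun_prop) (ae_Ioi fun κ hκ => ?_) (ae_Ioi fun τ hτ => ?_)
    · rw [lintegral_const_mul _ (by fun_prop)]
      rfl
    · rw [lintegral_Ioi_eq_mul_comp hτ (by fun_prop),
        ← lintegral_const_mul' _ _ ENNReal.ofReal_ne_top]
      refine setLIntegral_congr_fun measurableSet_Ioi fun κ (hκ : 0 < κ) => ?_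
      have e1 : τ * κ * τ / (τ * κ + τ) * ‖x‖ ^ 2 = κ / (κ + 1) * ‖x‖ ^ 2 * τ := by
        field_simp
      have e2 : τ * κ + τ = τ * (κ + 1) := by ring
      rw [← ENNReal.ofReal_mul (by positivity), ← ENNReal.ofReal_mul (by positivity), e1, e2, hD,
        mul_comm τ (‖x‖ ^ 2), div_rpow pi_pos.le (by positivity), mul_rpow hτ.le (by positivity),
        div_rpow hκ.le (by positivity), mul_rpow hτ.le (by positivity)]
      congr 1
      generalize exp (-(κ / (κ + 1) * ‖x‖ ^ 2 * τ)) - exp (-(‖x‖ ^ 2 * τ)) = X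
      have hτM := (rpow_pos_of_pos hτ M).ne'
      have hκM := (rpow_pos_of_pos (show 0 < κ + 1 by linarith) M).ne'
      have e3 : τ ^ (M + s - 1) * τ = τ ^ (s + M) := by
        rw [← rpow_add_one hτ.ne']; ring_nf
      have e4 : κ ^ (M + s - 1) = κ ^ (s - 1) * κ ^ M := by rw [← rpow_add hκ]; ring_nf
      have e5 : τ ^ (a + s - 1) = τ ^ (a - 1) * τ ^ s := by rw [← rpow_add hτ]; ring_nf
      rw [e4, e5]
      rw [rpow_add hτ] at e3
      field_simp
      rw [mul_comm τ, e3]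
      ring
  rw [step1, lintegral_eq_of_iterated (ν := volume.restrict (Ioi 0))
    (B := fun κ => ENNReal.ofReal (D * (Gamma (a + s) * ‖x‖ ^ (-(2 * (a + s)))) *
      (κ ^ (s - 1) * ((κ / (κ + 1)) ^ a - (κ / (κ + 1)) ^ M))))
    (fun τ κ => ENNReal.ofReal (D *
        (κ ^ (s - 1) * (κ / (κ + 1)) ^ M) * (τ ^ (a + s - 1) *
          (exp (-(κ / (κ + 1) * ‖x‖ ^ 2 * τ)) - exp (-(‖x‖ ^ 2 * τ))))))
    (by unfold Function.uncurry; fun_prop) (ae_of_all _ fun _ => rfl)]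
  · rw [lintegral_ofReal_const_mul (by positivity), lintegral_rpow_div_sub ha hs0 hs1 haM,
      ← ENNReal.ofReal_mul (by positivity), ← ENNReal.ofReal_mul (by positivity), hD, mul_add,
      neg_add, rpow_add hx', rpow_neg hx'.le, rpow_neg hx'.le]
    congr 1
    have := (rpow_pos_of_pos hx' (2 * a)).ne'
    field_simp
  · refine ae_Ioi fun κ hκ => ?_
    obtain ⟨h3, h4⟩ := div_add_one_mem hκ
    rw [lintegral_ofReal_const_mul (by positivity), lintegral_rpow_mul_exp_sub (by positivity)
      (by positivity) (mul_le_of_le_one_left (by positivity) h4.le),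
      ← ENNReal.ofReal_mul (by positivity)]
    congr 1
    rw [mul_rpow h3.le (by positivity), norm_rpow_two_mul, mul_neg]
    generalize κ / (κ + 1) = r at h3 h4
    have e : r ^ a = r ^ M * r ^ (-(a + s)) := by
      rw [← rpow_add h3]
      congr 1
      linarith
    rw [e]
    ring

/-- The Hardy integral `∫ |u(x)|² / |x - p|^(2s)` with values in `[0,∞]`. -/
def hardyInt (N : ℕ) (s : ℝ) (p : Eucl N) (u : Eucl N → ℝ) : ℝ≥0∞ :=
  ∫⁻ x, ENNReal.ofReal (u x ^ 2) * ENNReal.ofReal (1 / ‖x - p‖ ^ (2 * s))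

theorem fracConst_pos {N : ℕ} {s : ℝ} (hs0 : 0 < s) (hs1 : s < 1) : 0 < fracConst N s := by
  have h1 := Gamma_pos_of_pos (show 0 < ((N : ℝ) + 2 * s) / 2 by positivity)
  have h2 := Gamma_pos_of_pos (show 0 < 2 - s by linarith)
  have h3 : 0 < 1 - s := by linarith
  unfold fracConst
  positivity

theorem fracConst_eq {N : ℕ} {s : ℝ} (hs1 : s < 1) :
    fracConst N s = Gamma ((N : ℝ) / 2 + s) * (2 ^ (2 * s) * s /
      (π ^ ((N : ℝ) / 2) * Gamma (1 - s))) := by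
  have h1 := (Gamma_pos_of_pos (show 0 < 1 - s by linarith)).ne'
  have h2 : Gamma (2 - s) = (1 - s) * Gamma (1 - s) := by
    rw [← Gamma_add_one (by linarith)]
    congr 1
    ring
  have h3 : 1 - s ≠ 0 := by linarith
  unfold fracConst
  rw [h2, neg_div, rpow_neg pi_pos.le, show ((N : ℝ) + 2 * s) / 2 = (N : ℝ) / 2 + s by ring]
  have := (rpow_pos_of_pos pi_pos ((N : ℝ) / 2)).ne'
  field_simp

theorem gammaH_pos {N : ℕ} {s : ℝ} (hs0 : 0 < s) (hN : 2 * s < (N : ℝ)) : 0 < gammaH N s := by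
  have h1 := Gamma_pos_of_pos (show 0 < ((N : ℝ) + 2 * s) / 4 by positivity)
  have h2 := Gamma_pos_of_pos (show 0 < ((N : ℝ) - 2 * s) / 4 by linarith)
  unfold gammaH
  positivity

theorem two_mul_heatConst {N : ℕ} {s : ℝ} (hs0 : 0 < s) (hs1 : s < 1) (hN : 2 * s < (N : ℝ)) :
    fracConst N s / 2 * ((Gamma ((N : ℝ) / 2 + s))⁻¹ *
      (2 * (π ^ ((N : ℝ) / 2) * (Gamma (((N : ℝ) - 2 * s) / 4 + s) /
        Gamma (((N : ℝ) - 2 * s) / 4)) * powGap s (((N : ℝ) - 2 * s) / 4)))) = gammaH N s := by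
  have h1 := (Gamma_pos_of_pos (show 0 < 1 - s by linarith)).ne'
  have h2 := (Gamma_pos_of_pos (show 0 < ((N : ℝ) - 2 * s) / 4 by linarith)).ne'
  have h3 := (Gamma_pos_of_pos (show 0 < (N : ℝ) / 2 + s by positivity)).ne'
  have h4 := (rpow_pos_of_pos pi_pos ((N : ℝ) / 2)).ne'
  rw [fracConst_eq hs1]
  unfold gammaH powGap
  rw [show ((N : ℝ) + 2 * s) / 4 = ((N : ℝ) - 2 * s) / 4 + s by ring]
  generalize ((N : ℝ) - 2 * s) / 4 = a at *
  field_simp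

theorem measurable_poleAvg_prod {N : ℕ} (a : ℝ) {f : ℝ × Eucl N → ℝ → ℝ}
    (hf : Measurable (Function.uncurry f)) :
    Measurable fun p : ℝ × Eucl N => poleAvg a p.2 (f p) := by
  unfold poleAvg
  refine Measurable.lintegral_prod_right' (f := fun p : (ℝ × Eucl N) × ℝ =>
    ENNReal.ofReal (‖p.1.2‖ ^ (2 * a) * ((Gamma a)⁻¹ * p.2 ^ (a - 1)) * f p.1 p.2)) ?_
  have : Measurable fun p : (ℝ × Eucl N) × ℝ => f p.1 p.2 := hf
  fun_prop

theorem lintegral_weighted_poleAvg {N : ℕ} {s a : ℝ} {φ : Eucl N → ℝ} (hφ : Measurable φ)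
    (hN : 0 < N) {w : ℝ → ℝ} (hw : Measurable w) {f : ℝ × Eucl N → ℝ → ℝ}
    (hf : Measurable (Function.uncurry f)) {A : ℝ≥0∞}
    (hA : ∀ x : Eucl N, x ≠ 0 → ∫⁻ κ in Ioi (0 : ℝ), ENNReal.ofReal (w κ) *
      poleAvg a x (f (κ, x)) = A * ENNReal.ofReal (1 / ‖x‖ ^ (2 * s))) :
    ∫⁻ κ in Ioi (0 : ℝ), ENNReal.ofReal (w κ) *
        (2 * ∫⁻ x, ENNReal.ofReal (φ x ^ 2) * poleAvg a x (f (κ, x))) =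
      2 * A * hardyInt N s 0 φ := by
  have hm := measurable_poleAvg_prod a hf
  unfold hardyInt
  rw [← lintegral_const_mul _ (by fun_prop)]
  refine lintegral_eq_of_iterated (fun κ x => ENNReal.ofReal (w κ) *
    (2 * (ENNReal.ofReal (φ x ^ 2) * poleAvg a x (f (κ, x))))) ?_ (ae_of_all _ fun κ => ?_) ?_
  · exact (hw.comp measurable_fst).ennreal_ofReal.mul
      (((hφ.comp measurable_snd).pow_const 2).ennreal_ofReal.mul hm |>.const_mul 2)
  · have : Measurable fun x => poleAvg a x (f (κ, x)) :=
      measurable_poleAvg a (f := fun x => f (κ, x))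
        (hf.comp ((measurable_const.prodMk measurable_fst).prodMk measurable_snd))
    have h2 : Measurable fun x => ENNReal.ofReal (φ x ^ 2) * poleAvg a x (f (κ, x)) := by fun_prop
    rw [lintegral_const_mul _ (h2.const_mul 2), lintegral_const_mul _ h2]
  · filter_upwards [ae_ne_zero hN] with x hx
    have := hm.comp (measurable_prodMk_right (y := x))
    simp only [Function.comp_def] at this
    have h2 : Measurable fun κ => ENNReal.ofReal (w κ) * poleAvg a x (f (κ, x)) := by fun_prop
    calc _ = ∫⁻ κ in Ioi (0 : ℝ), 2 * ENNReal.ofReal (φ x ^ 2) *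
          (ENNReal.ofReal (w κ) * poleAvg a x (f (κ, x))) := lintegral_congr fun κ => by ring
      _ = 2 * ENNReal.ofReal (φ x ^ 2) * (A * ENNReal.ofReal (1 / ‖x‖ ^ (2 * s))) := by
        rw [lintegral_const_mul _ h2, hA x hx]
      _ = _ := by
        rw [sub_zero]
        ring

theorem hardy_of_lintegral_ne_top {N : ℕ} {s : ℝ} (hs0 : 0 < s) (hs1 : s < 1)
    (hN : 2 * s < (N : ℝ)) {φ : Eucl N → ℝ} (hφ : Measurable φ)
    (hφ2 : ∫⁻ x, ENNReal.ofReal (φ x ^ 2) ≠ ∞) (hφH : hardyInt N s 0 φ ≠ ∞) :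
    ENNReal.ofReal (gammaH N s) * hardyInt N s 0 φ ≤ energy N s φ := by
  have hN0 : 0 < N := by
    have : (0 : ℝ) < N := by linarith
    exact_mod_cast this
  set a : ℝ := ((N : ℝ) - 2 * s) / 4 with ha_def
  set M : ℝ := (N : ℝ) / 2 with hM_def
  have ha : 0 < a := by rw [ha_def]; linarith
  have hM : M = 2 * a + s := by rw [ha_def, hM_def]; ring
  have hMpos : 0 < M := by linarith
  have hGa := Gamma_pos_of_pos ha
  have hGb := Gamma_pos_of_pos (show 0 < a + s by linarith)
  have hK := powGap_pos hs0 hs1 ha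
  have hKM := powGap_mono ha hs0 hs1 (show a ≤ M by linarith)
  set B : ℝ := π ^ M * (Gamma (a + s) / Gamma a) with hB
  have hBpos : 0 < B := by positivity
  set w : ℝ → ℝ := fun κ => κ ^ (M + s - 1) with hw
  have hwm : Measurable w := by fun_prop
  set f : ℝ × Eucl N → ℝ → ℝ := fun p τ =>
    ((π / p.1) ^ M - (π / (p.1 + τ)) ^ M) * exp (-(τ * ‖p.2‖ ^ 2)) with hf
  set g : ℝ × Eucl N → ℝ → ℝ := fun p τ => (π / (p.1 + τ)) ^ M *
    (exp (-(p.1 * τ / (p.1 + τ) * ‖p.2‖ ^ 2)) - exp (-(τ * ‖p.2‖ ^ 2))) with hg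
  have hfm : Measurable (Function.uncurry f) := by rw [hf]; unfold Function.uncurry; fun_prop
  have hgm : Measurable (Function.uncurry g) := by rw [hg]; unfold Function.uncurry; fun_prop
  have hP := lintegral_weighted_poleAvg (s := s) hφ hN0 hwm hfm
    (fun x hx => lintegral_poleAvg_gap ha hs0 hs1 hMpos hx)
  have hQ := lintegral_weighted_poleAvg (s := s) hφ hN0 hwm hgm
    (fun x hx => lintegral_poleAvg_excess ha hs0 hs1 hM hx)
  have hsum : 2 * ENNReal.ofReal (B * powGap s M) * hardyInt N s 0 φ ≤
      heatForm N s (fun z => ENNReal.ofReal ((φ z.1 - φ z.2) ^ 2)) +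
        2 * ENNReal.ofReal (B * (powGap s M - powGap s a)) * hardyInt N s 0 φ := by
    rw [← hP, ← hQ]
    unfold heatForm
    rw [← lintegral_add_left]
    · refine lintegral_mono_ae (ae_Ioi fun κ hκ => ?_)
      rw [← mul_add]
      gcongr
      exact gaussForm_hardy ha hκ hN0 hφ hφ2
    · refine Measurable.mul (by fun_prop) ?_
      unfold gaussForm
      exact Measurable.lintegral_prod_right' (f := fun p : ℝ × (Eucl N × Eucl N) =>
        ENNReal.ofReal ((φ p.2.1 - φ p.2.2) ^ 2) *
          ENNReal.ofReal (exp (-(p.1 * ‖p.2.1 - p.2.2‖ ^ 2)))) (by fun_prop)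
  have hfin : 2 * ENNReal.ofReal (B * (powGap s M - powGap s a)) * hardyInt N s 0 φ ≠ ∞ :=
    ENNReal.mul_ne_top (ENNReal.mul_ne_top (by simp) ENNReal.ofReal_ne_top) hφH
  have hsplit : ENNReal.ofReal (B * powGap s M) = ENNReal.ofReal (B * powGap s a) +
      ENNReal.ofReal (B * (powGap s M - powGap s a)) := by
    rw [← ENNReal.ofReal_add (by positivity) (mul_nonneg hBpos.le (sub_nonneg.2 hKM))]
    congr 1
    ring
  rw [hsplit, mul_add, add_mul] at hsum
  have hmain := (ENNReal.add_le_add_iff_right hfin).1 hsum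
  rw [energy_eq_heatForm hs0 hφ, ← two_mul_heatConst hs0 hs1 hN, ← ha_def, ← hM_def, ← hB,
    ENNReal.ofReal_mul (by have := fracConst_pos (N := N) hs0 hs1; positivity),
    ENNReal.ofReal_mul (inv_nonneg.2 (Gamma_pos_of_pos (by positivity)).le),
    ENNReal.ofReal_mul zero_le_two, ENNReal.ofReal_ofNat, mul_assoc, mul_assoc]
  gcongr

/-- The Hardy integral of a Gaussian. -/
theorem lintegral_gaussian_div {N : ℕ} {s σ : ℝ} (hs0 : 0 < s) (hN : 2 * s < (N : ℝ))
    (hσ : 0 < σ) :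
    ∫⁻ x : Eucl N, ENNReal.ofReal (exp (-(σ * ‖x‖ ^ 2)) * (1 / ‖x‖ ^ (2 * s))) =
      ENNReal.ofReal (π ^ ((N : ℝ) / 2) * (Gamma ((N : ℝ) / 2 - s) / Gamma ((N : ℝ) / 2)) *
        σ ^ (s - (N : ℝ) / 2)) := by
  have hN0 : 0 < N := by
    have : (0 : ℝ) < N := by linarith
    exact_mod_cast this
  set M : ℝ := (N : ℝ) / 2 with hM_def
  have hM : 0 < M - s := by rw [hM_def]; linarith
  have hGs := Gamma_pos_of_pos hs0
  have hGM := Gamma_pos_of_pos (show 0 < M by linarith)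
  have hGMs := Gamma_pos_of_pos hM
  have step : ∫⁻ x : Eucl N, ENNReal.ofReal (exp (-(σ * ‖x‖ ^ 2)) * (1 / ‖x‖ ^ (2 * s))) =
      ∫⁻ ρ in Ioi (0 : ℝ), ENNReal.ofReal ((Gamma s)⁻¹ * (ρ ^ (s - 1) * (π / (σ + ρ)) ^ M)) := by
    refine lintegral_eq_of_iterated (fun (x : Eucl N) ρ => ENNReal.ofReal
      (exp (-(σ * ‖x‖ ^ 2)) * ((Gamma s)⁻¹ * (ρ ^ (s - 1) * exp (-(‖x‖ ^ 2 * ρ))))))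
      (by unfold Function.uncurry; fun_prop) ?_ (ae_Ioi fun ρ hρ => ?_)
    · filter_upwards [ae_ne_zero hN0] with x hx
      have hx' : 0 < ‖x‖ := norm_pos_iff.2 hx
      rw [lintegral_ofReal_const_mul (by positivity),
        lintegral_rpow_mul_exp_div hs0 (by positivity), ← ENNReal.ofReal_mul (by positivity),
        rpow_neg (by positivity), norm_rpow_two_mul, one_div]
    · calc _ = ∫⁻ x : Eucl N, ENNReal.ofReal (((Gamma s)⁻¹ * ρ ^ (s - 1)) *
            exp (-((σ + ρ) * ‖x‖ ^ 2))) := by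
            refine lintegral_congr fun x => ?_
            rw [add_mul, neg_add, exp_add, mul_comm ρ]
            congr 1
            ring
        _ = _ := by
            rw [lintegral_ofReal_const_mul (by positivity), lintegral_gaussian N (by linarith),
              ← ENNReal.ofReal_mul (by positivity), mul_assoc]
  have hbeta := lintegral_rpow_mul_one_add_rpow hs0 hM
  rw [add_sub_cancel] at hbeta
  rw [step, lintegral_Ioi_eq_mul_comp hσ (by fun_prop)]
  calc _ = ENNReal.ofReal σ * ∫⁻ ρ in Ioi (0 : ℝ), ENNReal.ofReal
        (((Gamma s)⁻¹ * (σ ^ (s - 1) * (π / σ) ^ M)) * (ρ ^ (s - 1) * (1 + ρ) ^ (-M))) := by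
        congr 1
        refine setLIntegral_congr_fun measurableSet_Ioi fun ρ (hρ : 0 < ρ) => ?_
        rw [show σ + σ * ρ = σ * (1 + ρ) by ring, mul_rpow hσ.le hρ.le, ← div_div,
          div_rpow (by positivity) (by positivity), rpow_neg (by positivity)]
        congr 1
        field_simp
    _ = _ := by
        rw [lintegral_ofReal_const_mul (by positivity), hbeta, ← ENNReal.ofReal_mul (by positivity),
          ← ENNReal.ofReal_mul (by positivity), div_rpow pi_pos.le hσ.le, rpow_sub hσ,
          rpow_sub hσ, rpow_one]
        congr 1
        have := (rpow_pos_of_pos hσ M).ne'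
        field_simp

/-! ### Energies of superpositions of Gaussians -/

theorem gaussForm_mono {N : ℕ} {F G : Eucl N × Eucl N → ℝ≥0∞} (h : ∀ z, F z ≤ G z) (κ : ℝ) :
    gaussForm F κ ≤ gaussForm G κ :=
  lintegral_mono fun z => mul_le_mul_left (h z) _

theorem heatForm_mono {N : ℕ} {s : ℝ} {F G : Eucl N × Eucl N → ℝ≥0∞} (h : ∀ z, F z ≤ G z) :
    heatForm N s F ≤ heatForm N s G :=
  lintegral_mono fun κ => mul_le_mul_right (gaussForm_mono h κ) _

theorem measurable_gaussForm {N : ℕ} {F : Eucl N × Eucl N → ℝ≥0∞} (hF : Measurable F) :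
    Measurable (gaussForm F) := by
  unfold gaussForm
  exact Measurable.lintegral_prod_right' (f := fun p : ℝ × (Eucl N × Eucl N) =>
    F p.2 * ENNReal.ofReal (exp (-(p.1 * ‖p.2.1 - p.2.2‖ ^ 2)))) (by fun_prop)

theorem heatForm_const_mul {N : ℕ} {s c : ℝ} (F : Eucl N × Eucl N → ℝ≥0∞) :
    heatForm N s (fun z => ENNReal.ofReal c * F z) = ENNReal.ofReal c * heatForm N s F := by
  unfold heatForm gaussForm
  rw [← lintegral_const_mul' _ _ ENNReal.ofReal_ne_top]
  refine lintegral_congr fun κ => ?_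
  simp_rw [mul_assoc]
  rw [lintegral_const_mul' _ _ ENNReal.ofReal_ne_top]
  ring

theorem heatForm_lintegral {N : ℕ} {s : ℝ} {β : Type*} [MeasurableSpace β] {ν : Measure β}
    [SFinite ν] {G : Eucl N × Eucl N → β → ℝ≥0∞} (hG : Measurable (Function.uncurry G)) :
    heatForm N s (fun z => ∫⁻ p, G z p ∂ν) = ∫⁻ p, heatForm N s (fun z => G z p) ∂ν := by
  have h2 : Measurable fun p : (ℝ × β) × (Eucl N × Eucl N) =>
      G p.2 p.1.2 * ENNReal.ofReal (exp (-(p.1.1 * ‖p.2.1 - p.2.2‖ ^ 2))) := by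
    have : Measurable fun p : (ℝ × β) × (Eucl N × Eucl N) => G p.2 p.1.2 :=
      hG.comp (measurable_snd.prodMk (measurable_snd.comp measurable_fst))
    fun_prop
  have h3 := h2.lintegral_prod_right' (ν := (volume : Measure (Eucl N × Eucl N)))
  have hp : ∀ p, Measurable fun z => G z p := fun p =>
    hG.comp (measurable_id.prodMk measurable_const)
  have hz : ∀ z, Measurable (G z) := fun z => hG.comp (measurable_const.prodMk measurable_id)
  unfold heatForm
  refine lintegral_eq_of_iterated (fun κ p => ENNReal.ofReal (κ ^ ((N : ℝ) / 2 + s - 1)) *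
    gaussForm (fun z => G z p) κ) ?_ (ae_of_all _ fun κ => ?_) (ae_of_all _ fun p => rfl)
  · have : Measurable fun p : ℝ × β => ENNReal.ofReal (p.1 ^ ((N : ℝ) / 2 + s - 1)) := by fun_prop
    exact this.mul h3
  · rw [lintegral_const_mul' _ _ ENNReal.ofReal_ne_top]
    congr 1
    unfold gaussForm
    simp_rw [← lintegral_mul_const _ (hz _)]
    refine lintegral_lintegral_swap ?_
    have : Measurable fun p : β × (Eucl N × Eucl N) => G p.2 p.1 :=
      hG.comp (measurable_snd.prodMk measurable_fst)
    have h4 : Measurable fun p : β × (Eucl N × Eucl N) =>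
      G p.2 p.1 * ENNReal.ofReal (exp (-(κ * ‖p.2.1 - p.2.2‖ ^ 2))) := by fun_prop
    exact h4.aemeasurable

theorem abs_exp_sub_mul_abs_exp_sub {τ τ' : ℝ} (hτ : 0 < τ) (hτ' : 0 < τ') (p q : ℝ) :
    |exp (-(τ * p)) - exp (-(τ * q))| * |exp (-(τ' * p)) - exp (-(τ' * q))| =
      (exp (-(τ * p)) - exp (-(τ * q))) * (exp (-(τ' * p)) - exp (-(τ' * q))) := by
  rw [← abs_mul, abs_of_nonneg]
  rcases le_total p q with h | h
  · exact mul_nonneg (sub_nonneg.2 (exp_le_exp.2 (by nlinarith)))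
      (sub_nonneg.2 (exp_le_exp.2 (by nlinarith)))
  · exact mul_nonneg_of_nonpos_of_nonpos (sub_nonpos.2 (exp_le_exp.2 (by nlinarith)))
      (sub_nonpos.2 (exp_le_exp.2 (by nlinarith)))

/-- The product of the increments of two Gaussians. -/
def gaussIncr {N : ℕ} (τ τ' : ℝ) (z : Eucl N × Eucl N) : ℝ :=
  |exp (-(τ * ‖z.1‖ ^ 2)) - exp (-(τ * ‖z.2‖ ^ 2))| *
    |exp (-(τ' * ‖z.1‖ ^ 2)) - exp (-(τ' * ‖z.2‖ ^ 2))|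

theorem gaussForm_gaussIncr {N : ℕ} {τ τ' κ : ℝ} (hτ : 0 < τ) (hτ' : 0 < τ') (hκ : 0 < κ) :
    gaussForm (N := N) (fun z => ENNReal.ofReal (gaussIncr τ τ' z)) κ =
      ENNReal.ofReal (2 * ((π / κ) ^ ((N : ℝ) / 2) * (π / (τ + τ')) ^ ((N : ℝ) / 2) *
        (1 - (κ / (κ + τ * τ' / (τ + τ'))) ^ ((N : ℝ) / 2)))) := by
  set M : ℝ := (N : ℝ) / 2 with hM_def
  let e : Eucl N × Eucl N → ℝ := fun z => exp (-(κ * ‖z.1 - z.2‖ ^ 2))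
  let g : ℝ → Eucl N → ℝ := fun t x => exp (-(t * ‖x‖ ^ 2))
  let X : Eucl N × Eucl N → ℝ≥0∞ := fun z => ENNReal.ofReal (g τ z.1 * (e z * g τ' z.2))
  let Y : Eucl N × Eucl N → ℝ≥0∞ := fun z => ENNReal.ofReal (g (τ + τ') z.1 * e z)
  have hXm : Measurable X := by fun_prop
  have hYm : Measurable Y := by fun_prop
  have hX : ∫⁻ z, X z = ENNReal.ofReal ((π / κ) ^ M * (π / (τ + τ')) ^ M *
      (κ / (κ + τ * τ' / (τ + τ'))) ^ M) := by
    rw [Measure.volume_eq_prod, lintegral_prod _ hXm.aemeasurable]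
    calc _ = ∫⁻ x : Eucl N, ENNReal.ofReal ((π / (κ + τ')) ^ M *
          exp (-((τ + κ * τ' / (κ + τ')) * ‖x‖ ^ 2))) := by
          refine lintegral_congr fun x => ?_
          simp only [X, e, g]
          rw [lintegral_ofReal_const_mul (by positivity), lintegral_gaussian_conv N hκ hτ',
            ← ENNReal.ofReal_mul (by positivity), add_mul, neg_add, exp_add]
          congr 1
          ring
      _ = _ := by
          rw [lintegral_ofReal_const_mul (by positivity), lintegral_gaussian N (by positivity),
            ← ENNReal.ofReal_mul (by positivity), ← mul_rpow (by positivity) (by positivity),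
            ← mul_rpow (by positivity) (by positivity), ← mul_rpow (by positivity) (by positivity)]
          congr 2
          field_simp
          ring
  have hY : ∫⁻ z, Y z = ENNReal.ofReal ((π / κ) ^ M * (π / (τ + τ')) ^ M) := by
    rw [Measure.volume_eq_prod, lintegral_prod _ hYm.aemeasurable]
    calc _ = ∫⁻ x : Eucl N, ENNReal.ofReal ((π / κ) ^ M * exp (-((τ + τ') * ‖x‖ ^ 2))) := by
          refine lintegral_congr fun x => ?_
          simp only [Y, e, g]
          rw [lintegral_ofReal_const_mul (by positivity), lintegral_gaussian_sub N hκ,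
            ← ENNReal.ofReal_mul (by positivity), mul_comm]
      _ = _ := by
          rw [lintegral_ofReal_const_mul (by positivity), lintegral_gaussian N (by positivity),
            ← ENNReal.ofReal_mul (by positivity)]
  have key : gaussForm (N := N) (fun z => ENNReal.ofReal (gaussIncr τ τ' z)) κ +
      2 * ∫⁻ z, X z = 2 * ∫⁻ z, Y z := by
    rw [two_mul, two_mul]
    nth_rewrite 2 [← lintegral_prod_comm_symm X]
    nth_rewrite 2 [← lintegral_prod_comm_symm Y]
    unfold gaussForm
    rw [← lintegral_add_left hXm, ← lintegral_add_left hYm, ← lintegral_add_right _ (by fun_prop)]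
    refine lintegral_congr fun z => ?_
    have h0 : 0 ≤ gaussIncr τ τ' z := by unfold gaussIncr; positivity
    simp only [X, Y, e, g, Prod.fst_swap, Prod.snd_swap]
    rw [norm_sub_rev z.2 z.1, ← ENNReal.ofReal_mul h0,
      ← ENNReal.ofReal_add (by positivity) (by positivity),
      ← ENNReal.ofReal_add (by positivity) (by positivity),
      ← ENNReal.ofReal_add (by positivity) (by positivity)]
    congr 1
    unfold gaussIncr
    rw [abs_exp_sub_mul_abs_exp_sub hτ hτ', add_mul, add_mul, neg_add, neg_add, exp_add, exp_add]
    ring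
  have hfin : 2 * ∫⁻ z, X z ≠ ∞ := by
    rw [hX]
    exact ENNReal.mul_ne_top (by simp) ENNReal.ofReal_ne_top
  rw [← ENNReal.add_left_inj hfin, key, hX, hY, ← ENNReal.ofReal_ofNat 2,
    ← ENNReal.ofReal_mul zero_le_two, ← ENNReal.ofReal_mul zero_le_two, ← ENNReal.ofReal_add]
  · congr 1
    ring
  · have h1 : κ / (κ + τ * τ' / (τ + τ')) ≤ 1 := by
      rw [div_le_one (by positivity)]
      have : 0 < τ * τ' / (τ + τ') := by positivity
      linarith
    have h2 : (κ / (κ + τ * τ' / (τ + τ'))) ^ M ≤ 1 :=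
      rpow_le_one (by positivity) h1 (by positivity)
    have := sub_nonneg.2 h2
    positivity
  · positivity

theorem heatForm_gaussIncr {N : ℕ} {s τ τ' : ℝ} (hs0 : 0 < s) (hs1 : s < 1) (hN : 0 < N)
    (hτ : 0 < τ) (hτ' : 0 < τ') :
    heatForm N s (fun z => ENNReal.ofReal (gaussIncr τ τ' z)) =
      ENNReal.ofReal (2 * π ^ (N : ℝ) * powGap s ((N : ℝ) / 2) *
        (τ ^ s * τ' ^ s * (τ + τ') ^ (-((N : ℝ) / 2 + s)))) := by
  set M : ℝ := (N : ℝ) / 2 with hM_def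
  have hM : 0 < M := by positivity
  have hsum : 0 < τ + τ' := by positivity
  unfold heatForm
  calc _ = ∫⁻ κ in Ioi (0 : ℝ), ENNReal.ofReal ((2 * π ^ M * (π / (τ + τ')) ^ M) *
        (κ ^ (s - 1) * (1 - (κ / (κ + τ * τ' / (τ + τ'))) ^ M))) := by
        refine setLIntegral_congr_fun measurableSet_Ioi fun κ (hκ : 0 < κ) => ?_
        rw [gaussForm_gaussIncr hτ hτ' hκ, ← ENNReal.ofReal_mul (by positivity), ← hM_def,
          div_rpow pi_pos.le hκ.le, show M + s - 1 = (s - 1) + M by ring, rpow_add hκ]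
        congr 1
        field_simp
    _ = _ := by
        rw [lintegral_ofReal_const_mul (by positivity),
          lintegral_one_sub_rpow_div hs0 hs1 (by positivity) hM,
          ← ENNReal.ofReal_mul (by positivity), div_rpow pi_pos.le hsum.le,
          div_rpow (by positivity) hsum.le, mul_rpow hτ.le hτ'.le, rpow_neg hsum.le,
          rpow_add hsum, show (N : ℝ) = M + M by rw [hM_def]; ring, rpow_add pi_pos]
        congr 1
        field_simp

/-! ### The almost extremal functions `(1 + |x|²)^(-q)` -/

/-- Lebesgue measure on the open quadrant. -/
def quadrant : Measure (ℝ × ℝ) :=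
  (volume.restrict (Ioi 0)).prod (volume.restrict (Ioi 0))

instance : SFinite quadrant := by unfold quadrant; infer_instance

theorem ae_quadrant {p : ℝ × ℝ → Prop} (h : ∀ x, 0 < x.1 → 0 < x.2 → p x) :
    ∀ᵐ x ∂quadrant, p x := by
  unfold quadrant
  rw [Measure.prod_restrict]
  exact ae_restrict_of_forall_mem (measurableSet_Ioi.prod measurableSet_Ioi)
    fun x hx => h x hx.1 hx.2

theorem lintegral_quadrant_mul {f g : ℝ → ℝ≥0∞} (hf : Measurable f) (hg : Measurable g) :
    ∫⁻ p, f p.1 * g p.2 ∂quadrant = (∫⁻ x in Ioi 0, f x) * ∫⁻ x in Ioi 0, g x := by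
  unfold quadrant
  exact lintegral_prod_mul hf.aemeasurable hg.aemeasurable

theorem lintegral_quadrant_add_rpow {r m : ℝ} (hm : 0 < m) (hr : m < 2 * r) :
    ∫⁻ p, ENNReal.ofReal ((p.1 ^ (r - 1) * exp (-p.1)) * (p.2 ^ (r - 1) * exp (-p.2)) *
        (p.1 + p.2) ^ (-m)) ∂quadrant =
      ENNReal.ofReal (Gamma r ^ 2 * Gamma (2 * r - m) / Gamma (2 * r)) := by
  have hr0 : 0 < r := by linarith
  have hGr := Gamma_pos_of_pos hr0
  have hGm := Gamma_pos_of_pos hm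
  rw [lintegral_eq_of_iterated (ν := volume.restrict (Ioi 0))
    (B := fun ρ => ENNReal.ofReal (((Gamma m)⁻¹ * Gamma r ^ 2) *
      (ρ ^ (m - 1) * (1 + ρ) ^ (-(2 * r)))))
    (fun p ρ => ENNReal.ofReal ((p.1 ^ (r - 1) * exp (-p.1)) * (p.2 ^ (r - 1) * exp (-p.2)) *
      ((Gamma m)⁻¹ * (ρ ^ (m - 1) * exp (-((p.1 + p.2) * ρ))))))
    (by unfold Function.uncurry; fun_prop)]
  · have h := lintegral_rpow_mul_one_add_rpow hm (show 0 < 2 * r - m by linarith)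
    rw [add_sub_cancel] at h
    rw [lintegral_ofReal_const_mul (by positivity), h, ← ENNReal.ofReal_mul (by positivity)]
    congr 1
    field_simp
  · refine ae_quadrant fun p hp1 hp2 => ?_
    rw [lintegral_ofReal_const_mul (by positivity), lintegral_rpow_mul_exp_div hm (by positivity),
      ← ENNReal.ofReal_mul (by positivity)]
  · refine ae_Ioi fun ρ hρ => ?_
    have h := lintegral_rpow_mul_exp hr0 (show 0 < 1 + ρ by linarith)
    calc _ = ∫⁻ p, ENNReal.ofReal (((Gamma m)⁻¹ * ρ ^ (m - 1)) *
            ((p.1 ^ (r - 1) * exp (-((1 + ρ) * p.1))) *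
              (p.2 ^ (r - 1) * exp (-((1 + ρ) * p.2))))) ∂quadrant := by
          refine lintegral_congr fun p => ?_
          rw [add_mul 1 ρ, add_mul 1 ρ, neg_add, neg_add, exp_add, exp_add, one_mul, one_mul,
            mul_comm (p.1 + p.2), mul_add, neg_add, exp_add]
          congr 1
          ring
      _ = ENNReal.ofReal ((Gamma m)⁻¹ * ρ ^ (m - 1)) * ∫⁻ p,
            ENNReal.ofReal (p.1 ^ (r - 1) * exp (-((1 + ρ) * p.1))) *
              ENNReal.ofReal (p.2 ^ (r - 1) * exp (-((1 + ρ) * p.2))) ∂quadrant := by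
          rw [lintegral_ofReal_const_mul (by positivity)]
          congr 1
          refine lintegral_congr_ae (ae_quadrant fun p hp1 hp2 => ?_)
          exact ENNReal.ofReal_mul (by positivity)
      _ = _ := by
          rw [lintegral_quadrant_mul (f := fun x => ENNReal.ofReal
            (x ^ (r - 1) * exp (-((1 + ρ) * x)))) (g := fun x => ENNReal.ofReal
            (x ^ (r - 1) * exp (-((1 + ρ) * x)))) (by fun_prop) (by fun_prop), h,
            ← ENNReal.ofReal_mul (by positivity), ← ENNReal.ofReal_mul (by positivity),
            two_mul r, neg_add, rpow_add (by positivity)]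
          congr 1
          ring

/-- The function `(1 + |x|²)^(-q)`. -/
def bubble {N : ℕ} (q : ℝ) (x : Eucl N) : ℝ := (1 + ‖x‖ ^ 2) ^ (-q)

theorem bubble_pos {N : ℕ} (q : ℝ) (x : Eucl N) : 0 < bubble q x := by
  unfold bubble
  positivity

theorem measurable_bubble {N : ℕ} (q : ℝ) : Measurable (bubble (N := N) q) := by
  unfold bubble
  fun_prop

/-- Weight representing the bubble as a superposition of Gaussians. -/
def bubbleWeight (q t : ℝ) : ℝ := (Gamma q)⁻¹ * (t ^ (q - 1) * exp (-t))

theorem measurable_bubbleWeight (q : ℝ) : Measurable (bubbleWeight q) := by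
  unfold bubbleWeight
  fun_prop

theorem bubbleWeight_nonneg {q t : ℝ} (hq : 0 < q) (ht : 0 < t) : 0 ≤ bubbleWeight q t := by
  have := Gamma_pos_of_pos hq
  unfold bubbleWeight
  positivity

theorem lintegral_bubbleWeight {N : ℕ} {q : ℝ} (hq : 0 < q) (x : Eucl N) :
    ∫⁻ t in Ioi (0 : ℝ), ENNReal.ofReal (bubbleWeight q t * exp (-(t * ‖x‖ ^ 2))) =
      ENNReal.ofReal (bubble q x) := by
  unfold bubble
  rw [← lintegral_rpow_mul_exp_div hq (show 0 < 1 + ‖x‖ ^ 2 by positivity)]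
  refine lintegral_congr fun t => ?_
  unfold bubbleWeight
  rw [add_mul, neg_add, exp_add, one_mul, mul_comm t]
  congr 1
  ring

theorem ofReal_abs_bubble_sub_le {N : ℕ} {q : ℝ} (hq : 0 < q) (x y : Eucl N) :
    ENNReal.ofReal |bubble q x - bubble q y| ≤ ∫⁻ t in Ioi (0 : ℝ),
      ENNReal.ofReal (bubbleWeight q t * |exp (-(t * ‖x‖ ^ 2)) - exp (-(t * ‖y‖ ^ 2))|) := by
  have hm := measurable_bubbleWeight q
  have aux : ∀ x y : Eucl N, ENNReal.ofReal (bubble q x - bubble q y) ≤ ∫⁻ t in Ioi (0 : ℝ),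
      ENNReal.ofReal (bubbleWeight q t * |exp (-(t * ‖x‖ ^ 2)) - exp (-(t * ‖y‖ ^ 2))|) := by
    intro x y
    rw [ENNReal.ofReal_sub _ (bubble_pos q y).le, tsub_le_iff_right, ← lintegral_bubbleWeight hq,
      ← lintegral_bubbleWeight hq, ← lintegral_add_left (by fun_prop)]
    refine lintegral_mono_ae (ae_Ioi fun t ht => ?_)
    have hw := bubbleWeight_nonneg hq ht
    rw [← ENNReal.ofReal_add (by positivity) (by positivity), ← mul_add]
    refine ENNReal.ofReal_le_ofReal (mul_le_mul_of_nonneg_left ?_ hw)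
    linarith [le_abs_self (exp (-(t * ‖x‖ ^ 2)) - exp (-(t * ‖y‖ ^ 2)))]
  rcases abs_choice (bubble q x - bubble q y) with h | h
  · rw [h]
    exact aux x y
  · rw [h, neg_sub]
    simp_rw [abs_sub_comm (exp (-(_ * ‖x‖ ^ 2)))]
    exact aux y x

theorem ofReal_sq_bubble_sub_le {N : ℕ} {q : ℝ} (hq : 0 < q) (z : Eucl N × Eucl N) :
    ENNReal.ofReal ((bubble q z.1 - bubble q z.2) ^ 2) ≤ ∫⁻ p,
      ENNReal.ofReal (bubbleWeight q p.1 * bubbleWeight q p.2) *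
        ENNReal.ofReal (gaussIncr p.1 p.2 z) ∂quadrant := by
  have hm := measurable_bubbleWeight q
  have h := ofReal_abs_bubble_sub_le hq z.1 z.2
  rw [← sq_abs, sq, ENNReal.ofReal_mul (abs_nonneg _)]
  refine (mul_le_mul' h h).trans_eq ?_
  rw [← lintegral_quadrant_mul (by fun_prop) (by fun_prop)]
  refine lintegral_congr_ae (ae_quadrant fun p hp1 hp2 => ?_)
  have h1 := bubbleWeight_nonneg hq hp1
  have h2 := bubbleWeight_nonneg hq hp2
  unfold gaussIncr
  dsimp only
  rw [← ENNReal.ofReal_mul (by positivity), ← ENNReal.ofReal_mul (by positivity)]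
  congr 1
  ring

theorem energy_bubble_le {N : ℕ} {s q : ℝ} (hs0 : 0 < s) (hs1 : s < 1) (hN : 2 * s < (N : ℝ))
    (hq : ((N : ℝ) - 2 * s) / 4 < q) :
    energy N s (bubble q) ≤ ENNReal.ofReal (2 ^ (2 * s) * π ^ ((N : ℝ) / 2) *
      (Gamma ((N : ℝ) / 2 + s) / Gamma ((N : ℝ) / 2)) * (Gamma (q + s) / Gamma q) ^ 2 *
      (Gamma (2 * q + s - (N : ℝ) / 2) / Gamma (2 * (q + s)))) := by
  have hN0 : 0 < N := by
    have : (0 : ℝ) < N := by linarith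
    exact_mod_cast this
  have hq0 : 0 < q := by linarith
  set M : ℝ := (N : ℝ) / 2 with hM_def
  have hM : 0 < M := by positivity
  have hGq := Gamma_pos_of_pos hq0
  have hK := powGap_pos hs0 hs1 hM
  have hwm := measurable_bubbleWeight q
  have hb := measurable_bubble (N := N) q
  have hheat : heatForm N s (fun z => ENNReal.ofReal ((bubble q z.1 - bubble q z.2) ^ 2)) ≤
      ENNReal.ofReal ((2 * π ^ (N : ℝ) * powGap s M * ((Gamma q)⁻¹) ^ 2) *
        (Gamma (q + s) ^ 2 * Gamma (2 * (q + s) - (M + s)) / Gamma (2 * (q + s)))) := by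
    refine (heatForm_mono (fun z => ofReal_sq_bubble_sub_le hq0 z)).trans_eq ?_
    rw [heatForm_lintegral (by unfold Function.uncurry gaussIncr; fun_prop),
      ENNReal.ofReal_mul (by positivity), ← lintegral_quadrant_add_rpow (by positivity)
        (by rw [hM_def]; linarith), ← lintegral_ofReal_const_mul (by positivity)]
    refine lintegral_congr_ae (ae_quadrant fun p hp1 hp2 => ?_)
    have h1 := bubbleWeight_nonneg hq0 hp1
    have h2 := bubbleWeight_nonneg hq0 hp2
    dsimp only
    rw [heatForm_const_mul, heatForm_gaussIncr hs0 hs1 hN0 hp1 hp2,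
      ← ENNReal.ofReal_mul (by positivity)]
    congr 1
    unfold bubbleWeight
    rw [show q + s - 1 = (q - 1) + s by ring, rpow_add hp1, rpow_add hp2]
    ring
  have hC := fracConst_pos (N := N) hs0 hs1
  have hGMs := Gamma_pos_of_pos (show 0 < M + s by linarith)
  rw [energy_eq_heatForm hs0 hb]
  refine (mul_le_mul_right (mul_le_mul_right hheat _) _).trans_eq ?_
  rw [← ENNReal.ofReal_mul (inv_nonneg.2 hGMs.le), ← ENNReal.ofReal_mul (by positivity),
    fracConst_eq hs1, ← hM_def, show (N : ℝ) = M + M by rw [hM_def]; ring, rpow_add pi_pos]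
  have hG1 := Gamma_pos_of_pos (show 0 < 1 - s by linarith)
  have hGM := Gamma_pos_of_pos hM
  unfold powGap
  rw [show 2 * (q + s) - (M + s) = 2 * q + s - M by ring]
  congr 1
  field_simp

theorem hardyInt_bubble {N : ℕ} {s q : ℝ} (hs0 : 0 < s) (hN : 2 * s < (N : ℝ))
    (hq : ((N : ℝ) - 2 * s) / 4 < q) :
    hardyInt N s 0 (bubble q) = ENNReal.ofReal (π ^ ((N : ℝ) / 2) *
      (Gamma ((N : ℝ) / 2 - s) / Gamma ((N : ℝ) / 2)) *
      (Gamma (2 * q + s - (N : ℝ) / 2) / Gamma (2 * q))) := by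
  have hq0 : 0 < q := by linarith
  have hN0 : (0 : ℝ) < N := by linarith
  set M : ℝ := (N : ℝ) / 2 with hM_def
  have hM : 0 < M := by positivity
  have hGM := Gamma_pos_of_pos hM
  have hGMs := Gamma_pos_of_pos (show 0 < M - s by rw [hM_def]; linarith)
  have hG2 := Gamma_pos_of_pos (show 0 < 2 * q by linarith)
  have hwm := measurable_bubbleWeight (2 * q)
  unfold hardyInt
  rw [lintegral_eq_of_iterated (ν := volume.restrict (Ioi 0))
    (B := fun t => ENNReal.ofReal ((π ^ M * (Gamma (M - s) / Gamma M) * (Gamma (2 * q))⁻¹) *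
      (t ^ (2 * q + s - M - 1) * exp (-(1 * t)))))
    (fun (x : Eucl N) t => ENNReal.ofReal (bubbleWeight (2 * q) t * exp (-(t * ‖x‖ ^ 2))) *
      ENNReal.ofReal (1 / ‖x‖ ^ (2 * s))) (by unfold Function.uncurry; fun_prop)]
  · rw [lintegral_ofReal_const_mul (by positivity),
      lintegral_rpow_mul_exp (by rw [hM_def]; linarith) one_pos,
      ← ENNReal.ofReal_mul (by positivity), one_rpow]
    congr 1
    field_simp
  · refine ae_of_all _ fun x => ?_
    rw [lintegral_mul_const _ (by fun_prop), lintegral_bubbleWeight (by linarith), sub_zero]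
    congr 2
    unfold bubble
    rw [← rpow_natCast ((1 + ‖x‖ ^ 2) ^ (-q)), ← rpow_mul (by positivity)]
    congr 1
    push_cast
    ring
  · refine ae_Ioi fun t ht => ?_
    have hw := bubbleWeight_nonneg (show 0 < 2 * q by linarith) ht
    calc _ = ENNReal.ofReal (bubbleWeight (2 * q) t) * ∫⁻ x : Eucl N,
          ENNReal.ofReal (exp (-(t * ‖x‖ ^ 2)) * (1 / ‖x‖ ^ (2 * s))) := by
          rw [← lintegral_ofReal_const_mul hw]
          refine lintegral_congr fun x => ?_
          rw [← ENNReal.ofReal_mul (by positivity), mul_assoc]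
      _ = _ := by
          rw [lintegral_gaussian_div hs0 hN ht, ← ENNReal.ofReal_mul hw, ← hM_def]
          unfold bubbleWeight
          rw [show 2 * q + s - M - 1 = (2 * q - 1) + (s - M) by ring, rpow_add ht, one_mul]
          congr 1
          ring

theorem exists_bubble_energy_lt {N : ℕ} {s L : ℝ} (hs0 : 0 < s) (hs1 : s < 1)
    (hN : 2 * s < (N : ℝ)) (hL : gammaH N s < L) :
    ∃ q, 0 < q ∧ energy N s (bubble q) < ENNReal.ofReal L * hardyInt N s 0 (bubble q) := by
  set a : ℝ := ((N : ℝ) - 2 * s) / 4 with ha_def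
  have ha : 0 < a := by rw [ha_def]; linarith
  have hM : (N : ℝ) / 2 = 2 * a + s := by rw [ha_def]; ring
  have hL0 : 0 < L := (gammaH_pos hs0 hN).trans hL
  let R : ℝ → ℝ := fun q => 2 ^ (2 * s) * (Gamma (q + s) / Gamma q) ^ 2 *
    (Gamma (2 * (a + s)) / Gamma (2 * (q + s))) * (Gamma (2 * q) / Gamma (2 * a))
  have hcont : ∀ x, 0 < x → ContinuousAt Gamma x := fun x hx =>
    (differentiableAt_Gamma fun m => by
      have : (0 : ℝ) ≤ m := m.cast_nonneg
      linarith).continuousAt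
  have hR : ContinuousAt R a := by
    have h1 : ContinuousAt (fun q => Gamma (q + s)) a :=
      ContinuousAt.comp (g := Gamma) (hcont _ (by linarith)) (by fun_prop)
    have h2 : ContinuousAt (fun q => Gamma (2 * (q + s))) a :=
      ContinuousAt.comp (g := Gamma) (hcont _ (by linarith)) (by fun_prop)
    have h3 : ContinuousAt (fun q => Gamma (2 * q)) a :=
      ContinuousAt.comp (g := Gamma) (hcont _ (by linarith)) (by fun_prop)
    have h4 := hcont a ha
    have n1 := (Gamma_pos_of_pos ha).ne'
    have n2 := (Gamma_pos_of_pos (show 0 < 2 * (a + s) by linarith)).ne'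
    exact ((continuousAt_const.mul ((h1.div h4 n1).pow 2)).mul
      (continuousAt_const.div h2 n2)).mul (h3.div_const _)
  have hRa : R a = gammaH N s := by
    have n2 := (Gamma_pos_of_pos (show 0 < 2 * (a + s) by linarith)).ne'
    have n3 := (Gamma_pos_of_pos (show 0 < 2 * a by linarith)).ne'
    simp only [R]
    unfold gammaH
    rw [← ha_def, show ((N : ℝ) + 2 * s) / 4 = a + s by rw [ha_def]; ring, div_self n2,
      div_self n3, div_pow, mul_one, mul_one]
  have hev : ∀ᶠ q in 𝓝[>] a, R q < L :=
    (hR.eventually_lt_const (hRa ▸ hL)).filter_mono nhdsWithin_le_nhds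
  obtain ⟨q, hqL, hq : a < q⟩ := (hev.and self_mem_nhdsWithin).exists
  refine ⟨q, ha.trans hq, ?_⟩
  have hq0 := ha.trans hq
  rw [hardyInt_bubble hs0 hN (ha_def ▸ hq), ← ENNReal.ofReal_mul hL0.le]
  refine (energy_bubble_le hs0 hs1 hN (ha_def ▸ hq)).trans_lt ?_
  have g0 := Gamma_pos_of_pos (show 0 < (N : ℝ) / 2 by linarith)
  have g1 := Gamma_pos_of_pos (show 0 < (N : ℝ) / 2 - s by linarith)
  have g2 := Gamma_pos_of_pos (show 0 < 2 * q + s - (N : ℝ) / 2 by linarith)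
  have g3 := Gamma_pos_of_pos (show 0 < 2 * q by linarith)
  have hpos : 0 < π ^ ((N : ℝ) / 2) * (Gamma ((N : ℝ) / 2 - s) / Gamma ((N : ℝ) / 2)) *
      (Gamma (2 * q + s - (N : ℝ) / 2) / Gamma (2 * q)) := by positivity
  rw [ENNReal.ofReal_lt_ofReal_iff (by positivity)]
  refine lt_of_eq_of_lt ?_ (mul_lt_mul_of_pos_right hqL hpos)
  simp only [R]
  rw [show 2 * (a + s) = (N : ℝ) / 2 + s by rw [hM]; ring,
    show 2 * a = (N : ℝ) / 2 - s by rw [hM]; ring]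
  generalize Gamma ((N : ℝ) / 2 - s) = g at g1
  generalize Gamma (2 * q + s - (N : ℝ) / 2) = g'
  field_simp

/-! ### Smooth truncation -/

/-- A smooth contraction of the line which vanishes on `(-∞,1]`. -/
def softTrunc (t : ℝ) : ℝ := ∫ r in (0 : ℝ)..t, smoothTransition (r - 1)

theorem continuous_smoothTransition_sub_one : Continuous fun r : ℝ => smoothTransition (r - 1) :=
  smoothTransition.continuous.comp (by fun_prop)

theorem hasDerivAt_softTrunc (t : ℝ) : HasDerivAt softTrunc (smoothTransition (t - 1)) t :=
  intervalIntegral.integral_hasDerivAt_right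
    (continuous_smoothTransition_sub_one.intervalIntegrable _ _)
    (continuous_smoothTransition_sub_one.stronglyMeasurableAtFilter _ _)
    continuous_smoothTransition_sub_one.continuousAt

theorem contDiff_softTrunc : ContDiff ℝ ((⊤ : ℕ∞) : WithTop ℕ∞) softTrunc := by
  rw [contDiff_infty_iff_deriv]
  refine ⟨fun t => (hasDerivAt_softTrunc t).differentiableAt, ?_⟩
  rw [show deriv softTrunc = fun t => smoothTransition (t - 1) from
    funext fun t => (hasDerivAt_softTrunc t).deriv]
  exact smoothTransition.contDiff.comp (by fun_prop)

theorem softTrunc_of_le_one {t : ℝ} (ht : t ≤ 1) : softTrunc t = 0 := by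
  unfold softTrunc
  rw [intervalIntegral.integral_congr (g := fun _ => (0 : ℝ)), intervalIntegral.integral_zero]
  intro r hr
  refine smoothTransition.zero_of_nonpos ?_
  have := hr.2
  have h2 : max 0 t ≤ 1 := max_le zero_le_one ht
  linarith

theorem monotone_softTrunc : Monotone softTrunc :=
  monotone_of_deriv_nonneg (fun t => (hasDerivAt_softTrunc t).differentiableAt) fun t => by
    rw [(hasDerivAt_softTrunc t).deriv]
    exact smoothTransition.nonneg _

theorem monotone_sub_softTrunc : Monotone fun t => t - softTrunc t := by
  have hd : ∀ t, HasDerivAt (fun t => t - softTrunc t) (1 - smoothTransition (t - 1)) t :=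
    fun t => (hasDerivAt_id t).sub (hasDerivAt_softTrunc t)
  refine monotone_of_deriv_nonneg (fun t => (hd t).differentiableAt) fun t => ?_
  rw [(hd t).deriv]
  exact sub_nonneg.2 (smoothTransition.le_one _)

theorem abs_softTrunc_sub_le (t r : ℝ) : |softTrunc t - softTrunc r| ≤ |t - r| := by
  wlog h : r ≤ t generalizing t r
  · rw [abs_sub_comm, abs_sub_comm t]
    exact this r t (le_of_not_ge h)
  have h1 := monotone_softTrunc h
  have h2 := monotone_sub_softTrunc h
  dsimp only at h2
  rw [abs_of_nonneg (sub_nonneg.2 h1), abs_of_nonneg (sub_nonneg.2 h)]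
  linarith

theorem sub_two_le_softTrunc (t : ℝ) : t - 2 ≤ softTrunc t := by
  rcases le_total t 2 with h | h
  · have h0 : 0 ≤ softTrunc t := by
      rcases le_total t 1 with h1 | h1
      · rw [softTrunc_of_le_one h1]
      · rw [← softTrunc_of_le_one le_rfl]
        exact monotone_softTrunc h1
    linarith
  · have hd : ∀ r, 2 ≤ r → HasDerivAt (fun r => softTrunc r - r) 0 r := fun r hr => by
      have := (hasDerivAt_softTrunc r).sub (hasDerivAt_id r)
      rwa [smoothTransition.one_of_one_le (by linarith), sub_self] at this
    have hc := constant_of_has_deriv_right_zero (a := 2) (b := t)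
      (f := fun r => softTrunc r - r)
      (fun r hr => (hd r hr.1).continuousAt.continuousWithinAt)
      (fun r hr => (hd r hr.1).hasDerivWithinAt) t ⟨h, le_rfl⟩
    have h0 : 0 ≤ softTrunc 2 := by
      rw [← softTrunc_of_le_one le_rfl]
      exact monotone_softTrunc one_le_two
    linarith

theorem softTrunc_le {t : ℝ} (ht : 0 ≤ t) : softTrunc t ≤ t := by
  have := monotone_sub_softTrunc ht
  dsimp only at this
  rw [softTrunc_of_le_one zero_le_one] at this
  linarith

theorem tendsto_bubble_cocompact {N : ℕ} {q : ℝ} (hq : 0 < q) :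
    Tendsto (bubble (N := N) q) (cocompact _) (𝓝 0) := by
  have h1 : Tendsto (fun x : Eucl N => 1 + ‖x‖ ^ 2) (cocompact _) atTop :=
    tendsto_atTop_add_const_left _ _ ((tendsto_pow_atTop two_ne_zero).comp
      (tendsto_norm_cocompact_atTop (E := Eucl N)))
  exact (tendsto_rpow_neg_atTop hq).comp h1

theorem contDiff_bubble {N : ℕ} (q : ℝ) :
    ContDiff ℝ ((⊤ : ℕ∞) : WithTop ℕ∞) (bubble (N := N) q) := by
  unfold bubble
  refine ContDiff.rpow_const_of_ne ?_ fun x => by positivity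
  exact contDiff_const.add (contDiff_norm_sq ℝ)

/-- Smooth truncation of the bubble at height `δ`. -/
def truncBubble {N : ℕ} (q δ : ℝ) (x : Eucl N) : ℝ := δ * softTrunc (δ⁻¹ * bubble q x)

theorem isTestFunction_truncBubble {N : ℕ} {q δ : ℝ} (hq : 0 < q) (hδ : 0 < δ) :
    IsTestFunction N (truncBubble q δ) := by
  refine ⟨contDiff_const.mul (contDiff_softTrunc.comp (contDiff_const.mul (contDiff_bubble q))), ?_⟩
  have h := (tendsto_bubble_cocompact (N := N) hq).eventually_lt_const hδ
  obtain ⟨K, hK, hKs⟩ := mem_cocompact.1 h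
  refine HasCompactSupport.intro hK fun x hx => ?_
  have hx' : bubble q x < δ := hKs hx
  unfold truncBubble
  rw [softTrunc_of_le_one, mul_zero]
  rw [inv_mul_le_iff₀ hδ]
  linarith

theorem sq_truncBubble_sub_le {N : ℕ} {q δ : ℝ} (hδ : 0 < δ) (x y : Eucl N) :
    (truncBubble q δ x - truncBubble q δ y) ^ 2 ≤ (bubble q x - bubble q y) ^ 2 := by
  rw [sq_le_sq]
  unfold truncBubble
  rw [← mul_sub, abs_mul, abs_of_pos hδ]
  refine (mul_le_mul_of_nonneg_left (abs_softTrunc_sub_le _ _) hδ.le).trans_eq ?_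
  rw [← mul_sub, abs_mul, abs_of_pos (inv_pos.2 hδ), ← mul_assoc, mul_inv_cancel₀ hδ.ne', one_mul]

theorem energy_truncBubble_le {N : ℕ} {s q δ : ℝ} (hδ : 0 < δ) :
    energy N s (truncBubble q δ) ≤ energy N s (bubble q) := by
  unfold energy
  refine mul_le_mul_right (lintegral_mono fun z => ENNReal.ofReal_le_ofReal ?_) _
  exact div_le_div_of_nonneg_right (sq_truncBubble_sub_le hδ _ _) (by positivity)

theorem tendsto_truncBubble {N : ℕ} (q : ℝ) (x : Eucl N) :
    Tendsto (fun n : ℕ => truncBubble q (1 / ((n : ℝ) + 1)) x) atTop (𝓝 (bubble q x)) := by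
  have h0 := tendsto_one_div_add_atTop_nhds_zero_nat (𝕜 := ℝ)
  have h1 : Tendsto (fun n : ℕ => bubble q x - 2 * (1 / ((n : ℝ) + 1))) atTop
      (𝓝 (bubble q x - 2 * 0)) := tendsto_const_nhds.sub (h0.const_mul 2)
  rw [mul_zero, sub_zero] at h1
  refine tendsto_of_tendsto_of_tendsto_of_le_of_le h1 tendsto_const_nhds (fun n => ?_) fun n => ?_
  · have hδ : 0 < 1 / ((n : ℝ) + 1) := by positivity
    generalize 1 / ((n : ℝ) + 1) = δ at hδ
    have := mul_le_mul_of_nonneg_left (sub_two_le_softTrunc (δ⁻¹ * bubble q x)) hδ.le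
    rw [mul_sub, ← mul_assoc, mul_inv_cancel₀ hδ.ne', one_mul] at this
    unfold truncBubble
    linarith
  · have hδ : 0 < 1 / ((n : ℝ) + 1) := by positivity
    dsimp only
    generalize 1 / ((n : ℝ) + 1) = δ at hδ
    have hb := bubble_pos q x
    have := mul_le_mul_of_nonneg_left (softTrunc_le (show 0 ≤ δ⁻¹ * bubble q x by positivity)) hδ.le
    rwa [← mul_assoc, mul_inv_cancel₀ hδ.ne', one_mul] at this

/-! ### Test functions -/

theorem IsTestFunction.continuous {N : ℕ} {φ : Eucl N → ℝ} (hφ : IsTestFunction N φ) :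
    Continuous φ := hφ.1.continuous

theorem IsTestFunction.exists_radius {N : ℕ} {φ : Eucl N → ℝ} (hφ : IsTestFunction N φ) :
    ∃ R, 0 < R ∧ ∀ x, φ x ≠ 0 → ‖x‖ ≤ R := by
  obtain ⟨R, hR, h⟩ := (hφ.2.isCompact.isBounded).exists_pos_norm_le
  exact ⟨R, hR, fun x hx => h x (subset_tsupport φ hx)⟩

theorem IsTestFunction.exists_sq_le_gaussian {N : ℕ} {φ : Eucl N → ℝ} (hφ : IsTestFunction N φ) :
    ∃ C, 0 ≤ C ∧ ∀ x, φ x ^ 2 ≤ C * exp (-(1 * ‖x‖ ^ 2)) := by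
  have hc := hφ.continuous
  have hs : HasCompactSupport fun x => φ x * (φ x * exp (‖x‖ ^ 2)) := hφ.2.mul_right
  obtain ⟨C, hC⟩ := hs.exists_bound_of_continuous (by fun_prop)
  refine ⟨C, (norm_nonneg _).trans (hC 0), fun x => ?_⟩
  have h := (le_abs_self _).trans (hC x)
  rw [exp_neg, ← div_eq_mul_inv, le_div_iff₀ (exp_pos _), one_mul]
  linarith

theorem IsTestFunction.lintegral_sq_ne_top {N : ℕ} {φ : Eucl N → ℝ} (hφ : IsTestFunction N φ) :
    ∫⁻ x, ENNReal.ofReal (φ x ^ 2) ≠ ∞ := by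
  obtain ⟨C, hC, h⟩ := hφ.exists_sq_le_gaussian
  refine ne_top_of_le_ne_top ?_ (lintegral_mono fun x => ENNReal.ofReal_le_ofReal (h x))
  rw [lintegral_ofReal_const_mul hC, lintegral_gaussian N one_pos]
  exact ENNReal.mul_ne_top ENNReal.ofReal_ne_top ENNReal.ofReal_ne_top

theorem IsTestFunction.hardyInt_zero_ne_top {N : ℕ} {s : ℝ} {φ : Eucl N → ℝ}
    (hφ : IsTestFunction N φ) (hs0 : 0 < s) (hN : 2 * s < (N : ℝ)) : hardyInt N s 0 φ ≠ ∞ := by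
  obtain ⟨C, hC, h⟩ := hφ.exists_sq_le_gaussian
  have h2 : hardyInt N s 0 φ ≤ ∫⁻ x : Eucl N, ENNReal.ofReal
      (C * (exp (-(1 * ‖x‖ ^ 2)) * (1 / ‖x‖ ^ (2 * s)))) := by
    refine lintegral_mono fun x => ?_
    rw [← ENNReal.ofReal_mul (sq_nonneg _), sub_zero, ← mul_assoc]
    exact ENNReal.ofReal_le_ofReal (mul_le_mul_of_nonneg_right (h x) (by positivity))
  refine ne_top_of_le_ne_top ?_ h2
  rw [lintegral_ofReal_const_mul hC, lintegral_gaussian_div hs0 hN one_pos]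
  exact ENNReal.mul_ne_top ENNReal.ofReal_ne_top ENNReal.ofReal_ne_top

theorem IsTestFunction.exists_sq_sub_le {N : ℕ} {φ : Eucl N → ℝ} (hφ : IsTestFunction N φ) :
    ∃ C, 0 ≤ C ∧ ∀ x y, (φ x - φ y) ^ 2 ≤ C *
      ((exp (-(1 * ‖x‖ ^ 2)) + exp (-(1 * ‖y‖ ^ 2))) * (1 - exp (-(1 * ‖x - y‖ ^ 2)))) := by
  obtain ⟨R, hR, hsupp⟩ := hφ.exists_radius
  obtain ⟨L, hL⟩ := ContDiff.lipschitzWith_of_hasCompactSupport hφ.2 hφ.1 (by simp)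
  obtain ⟨B, hB⟩ := hφ.2.exists_bound_of_continuous hφ.continuous
  refine ⟨((L : ℝ) ^ 2 + 4 * B ^ 2) * exp (R ^ 2), by positivity, fun x y => ?_⟩
  set r := ‖x - y‖ ^ 2 with hr
  have hr0 : 0 ≤ r := sq_nonneg _
  have h1 : (φ x - φ y) ^ 2 ≤ (L : ℝ) ^ 2 * r := by
    rw [hr, ← mul_pow, sq_le_sq, abs_of_nonneg (show 0 ≤ (L : ℝ) * ‖x - y‖ by positivity)]
    have := hL.dist_le_mul x y
    rwa [dist_eq_norm, dist_eq_norm, norm_eq_abs] at this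
  have h2 : (φ x - φ y) ^ 2 ≤ 4 * B ^ 2 := by
    rw [show 4 * B ^ 2 = (2 * B) ^ 2 by ring, sq_le_sq]
    have hx := hB x
    have hy := hB y
    rw [norm_eq_abs] at hx hy
    have := abs_sub (φ x) (φ y)
    exact le_trans (by linarith) (le_abs_self _)
  have h3 : (φ x - φ y) ^ 2 ≤ ((L : ℝ) ^ 2 + 4 * B ^ 2) * (1 - exp (-(1 * r))) := by
    have he : exp (-(1 * r)) ≤ 1 / (1 + r) := by
      rw [one_mul, exp_neg, ← one_div]
      exact one_div_le_one_div_of_le (by linarith) (by linarith [add_one_le_exp r])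
    have h4 : (φ x - φ y) ^ 2 ≤ ((L : ℝ) ^ 2 + 4 * B ^ 2) * (1 - 1 / (1 + r)) := by
      rw [show 1 - 1 / (1 + r) = r / (1 + r) by field_simp; ring, ← mul_div_assoc,
        le_div_iff₀ (by linarith)]
      nlinarith
    refine h4.trans (mul_le_mul_of_nonneg_left (by linarith) (by positivity))
  by_cases hxy : φ x = 0 ∧ φ y = 0
  · rw [hxy.1, hxy.2, sub_zero, zero_pow two_ne_zero]
    have : exp (-(1 * r)) ≤ 1 := exp_le_one_iff.2 (by linarith)
    have := sub_nonneg.2 this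
    positivity
  · have hgauss : ∀ w : Eucl N, φ w ≠ 0 → 1 ≤ exp (R ^ 2) * exp (-(1 * ‖w‖ ^ 2)) := fun w hw => by
      rw [← exp_add, one_le_exp_iff]
      nlinarith [hsupp w hw, norm_nonneg w]
    have h5 : 1 ≤ exp (R ^ 2) * (exp (-(1 * ‖x‖ ^ 2)) + exp (-(1 * ‖y‖ ^ 2))) := by
      rw [mul_add]
      rcases not_and_or.1 hxy with h | h
      · have := hgauss x h
        have : 0 ≤ exp (R ^ 2) * exp (-(1 * ‖y‖ ^ 2)) := by positivity
        linarith
      · have := hgauss y h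
        have : 0 ≤ exp (R ^ 2) * exp (-(1 * ‖x‖ ^ 2)) := by positivity
        linarith
    calc _ ≤ _ := h3
      _ ≤ ((L : ℝ) ^ 2 + 4 * B ^ 2) * (1 - exp (-(1 * r))) *
          (exp (R ^ 2) * (exp (-(1 * ‖x‖ ^ 2)) + exp (-(1 * ‖y‖ ^ 2)))) :=
        le_mul_of_one_le_right ((sq_nonneg _).trans h3) h5
      _ = _ := by ring

theorem heatForm_add {N : ℕ} {s : ℝ} {F : Eucl N × Eucl N → ℝ≥0∞} (hF : Measurable F)
    (G : Eucl N × Eucl N → ℝ≥0∞) :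
    heatForm N s (fun z => F z + G z) = heatForm N s F + heatForm N s G := by
  have hm := measurable_gaussForm hF
  unfold heatForm
  rw [← lintegral_add_left (by fun_prop)]
  refine lintegral_congr fun κ => ?_
  unfold gaussForm
  simp_rw [add_mul]
  rw [lintegral_add_left (by fun_prop), mul_add]

theorem IsTestFunction.energy_ne_top {N : ℕ} {s : ℝ} {φ : Eucl N → ℝ}
    (hφ : IsTestFunction N φ) (hs0 : 0 < s) (hs1 : s < 1) (hN : 0 < N) : energy N s φ ≠ ∞ := by
  obtain ⟨C, hC, h⟩ := hφ.exists_sq_sub_le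
  set M : ℝ := (N : ℝ) / 2 with hM_def
  have hM : 0 < M := by positivity
  let W : Eucl N × Eucl N → ℝ≥0∞ := fun z =>
    ENNReal.ofReal (exp (-(1 * ‖z.1‖ ^ 2)) * (1 - exp (-(1 * ‖z.1 - z.2‖ ^ 2))))
  have hWm : Measurable W := by fun_prop
  have hW : ∀ κ, 0 < κ → gaussForm W κ =
      ENNReal.ofReal (π ^ M * ((π / κ) ^ M - (π / (κ + 1)) ^ M)) := by
    intro κ hκ
    unfold gaussForm
    rw [Measure.volume_eq_prod, lintegral_prod _ (by fun_prop)]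
    calc _ = ∫⁻ x : Eucl N, ENNReal.ofReal (((π / κ) ^ M - (π / (κ + 1)) ^ M) *
          exp (-(1 * ‖x‖ ^ 2))) := by
          refine lintegral_congr fun x => ?_
          have e1 := lintegral_gaussian_sub N hκ x
          have e2 := lintegral_gaussian_sub N (show 0 < κ + 1 by linarith) x
          rw [mul_comm, ENNReal.ofReal_mul (exp_pos _).le, ENNReal.ofReal_sub _ (by positivity),
            ← e1, ← e2, ← lintegral_sub (by fun_prop) (by rw [e2]; exact ENNReal.ofReal_ne_top),
            ← lintegral_const_mul' _ _ ENNReal.ofReal_ne_top]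
          · refine lintegral_congr fun y => ?_
            simp only [W]
            rw [← ENNReal.ofReal_sub _ (exp_pos _).le, ← ENNReal.ofReal_mul (exp_pos _).le,
              ← ENNReal.ofReal_mul' (exp_pos _).le, add_mul, neg_add, exp_add]
            congr 1
            ring
          · refine ae_of_all _ fun y => ENNReal.ofReal_le_ofReal (exp_le_exp.2 ?_)
            nlinarith [sq_nonneg ‖x - y‖]
      _ = _ := by
          rw [lintegral_ofReal_const_mul (sub_nonneg.2 (div_add_rpow_le hκ one_pos hM.le)),
            lintegral_gaussian N one_pos, ← ENNReal.ofReal_mul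
              (sub_nonneg.2 (div_add_rpow_le hκ one_pos hM.le)), div_one, mul_comm]
  have hheatW : heatForm N s W ≠ ∞ := by
    have : heatForm N s W = ENNReal.ofReal (π ^ M * π ^ M) *
        ENNReal.ofReal (powGap s M * 1 ^ s) := by
      rw [← lintegral_one_sub_rpow_div hs0 hs1 one_pos hM, ← lintegral_ofReal_const_mul
        (by positivity)]
      refine setLIntegral_congr_fun measurableSet_Ioi fun κ (hκ : 0 < κ) => ?_
      rw [hW κ hκ, ← ENNReal.ofReal_mul (by positivity), mul_assoc (π ^ M) (π ^ M),
        ← rpow_mul_pi_div_sub hκ one_pos, ← hM_def]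
      congr 1
      ring
    rw [this]
    exact ENNReal.mul_ne_top ENNReal.ofReal_ne_top ENNReal.ofReal_ne_top
  have hswap : heatForm N s (fun z => W z.swap) = heatForm N s W := by
    unfold heatForm gaussForm
    refine lintegral_congr fun κ => ?_
    rw [← lintegral_prod_comm_symm]
    simp_rw [Prod.swap_swap, Prod.fst_swap, Prod.snd_swap, norm_sub_rev (Prod.snd _)]
  have hbound : heatForm N s (fun z => ENNReal.ofReal ((φ z.1 - φ z.2) ^ 2)) ≤
      ENNReal.ofReal C * (heatForm N s W + heatForm N s (fun z => W z.swap)) := by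
    rw [← heatForm_add hWm, ← heatForm_const_mul]
    refine heatForm_mono fun z => ?_
    have hle : exp (-(1 * ‖z.1 - z.2‖ ^ 2)) ≤ 1 :=
      exp_le_one_iff.2 (by nlinarith [sq_nonneg ‖z.1 - z.2‖])
    have hle' := sub_nonneg.2 hle
    simp only [W, Prod.fst_swap, Prod.snd_swap]
    rw [norm_sub_rev z.2 z.1, ← ENNReal.ofReal_add (by positivity) (by positivity),
      ← ENNReal.ofReal_mul hC, ← add_mul]
    exact ENNReal.ofReal_le_ofReal (h _ _)
  rw [energy_eq_heatForm hs0 hφ.continuous.measurable]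
  refine ENNReal.mul_ne_top ENNReal.ofReal_ne_top (ENNReal.mul_ne_top ENNReal.ofReal_ne_top
    (ne_top_of_le_ne_top (ENNReal.mul_ne_top ENNReal.ofReal_ne_top ?_) hbound))
  rw [hswap]
  exact ENNReal.add_ne_top.2 ⟨hheatW, hheatW⟩

/-! ### The Hardy inequality on the homogeneous Sobolev space -/

theorem ae_ne {N : ℕ} (hN : 0 < N) (p : Eucl N) : ∀ᵐ y : Eucl N, y ≠ p := by
  have : Nonempty (Fin N) := ⟨⟨0, hN⟩⟩
  simp [ae_iff]

theorem hardyInt_le_liminf {N : ℕ} {s : ℝ} (hN : 0 < N) {p : Eucl N} {u : Eucl N → ℝ}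
    {pn : ℕ → Eucl N} {v : ℕ → Eucl N → ℝ} (hp : Tendsto pn atTop (𝓝 p))
    (hv : ∀ n, Measurable (v n)) (hvu : ∀ᵐ x, Tendsto (fun n => v n x) atTop (𝓝 (u x))) :
    hardyInt N s p u ≤ liminf (fun n => hardyInt N s (pn n) (v n)) atTop := by
  unfold hardyInt
  refine le_trans (le_of_eq ?_) (lintegral_liminf_le fun n => by fun_prop)
  refine lintegral_congr_ae ?_
  filter_upwards [hvu, ae_ne hN p] with x hx hxp
  have hxp' : 0 < ‖x - p‖ := norm_pos_iff.2 (sub_ne_zero.2 hxp)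
  have h1 : Tendsto (fun n => v n x ^ 2) atTop (𝓝 (u x ^ 2)) := hx.pow 2
  have h2 : Tendsto (fun n => 1 / ‖x - pn n‖ ^ (2 * s)) atTop (𝓝 (1 / ‖x - p‖ ^ (2 * s))) :=
    tendsto_const_nhds.div ((tendsto_const_nhds.sub hp).norm.rpow_const (Or.inl hxp'.ne'))
      (rpow_pos_of_pos hxp' _).ne'
  have h3 := ENNReal.tendsto_ofReal (h1.mul h2)
  simp_rw [ENNReal.ofReal_mul (sq_nonneg _)] at h3
  exact h3.liminf_eq.symm

theorem isTestFunction_translate {N : ℕ} {φ : Eucl N → ℝ} (hφ : IsTestFunction N φ)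
    (p : Eucl N) : IsTestFunction N (fun x => φ (x + p)) :=
  ⟨hφ.1.comp (contDiff_id.add contDiff_const),
    hφ.2.comp_homeomorph (Homeomorph.addRight p)⟩

theorem energy_translate {N : ℕ} {s : ℝ} {φ : Eucl N → ℝ} (hφ : Measurable φ) (p : Eucl N) :
    energy N s (fun x => φ (x + p)) = energy N s φ := by
  unfold energy
  congr 1
  have hmp : MeasurePreserving (fun z : Eucl N × Eucl N => (z.1 + p, z.2 + p))
      (volume.prod volume) (volume.prod volume) :=
    (measurePreserving_add_right volume p).prod (measurePreserving_add_right volume p)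
  rw [Measure.volume_eq_prod]
  conv_rhs => rw [← hmp.lintegral_comp (by fun_prop)]
  simp

theorem hardyInt_translate {N : ℕ} {s : ℝ} (φ : Eucl N → ℝ) (p : Eucl N) :
    hardyInt N s 0 (fun x => φ (x + p)) = hardyInt N s p φ := by
  unfold hardyInt
  rw [← lintegral_add_right_eq_self
    (fun x => ENNReal.ofReal (φ x ^ 2) * ENNReal.ofReal (1 / ‖x - p‖ ^ (2 * s))) p]
  simp

theorem IsTestFunction.hardyInt_ne_top {N : ℕ} {s : ℝ} {φ : Eucl N → ℝ}
    (hφ : IsTestFunction N φ) (hs0 : 0 < s) (hN : 2 * s < (N : ℝ)) (p : Eucl N) :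
    hardyInt N s p φ ≠ ∞ := by
  rw [← hardyInt_translate]
  exact (isTestFunction_translate hφ p).hardyInt_zero_ne_top hs0 hN

theorem IsTestFunction.hardy {N : ℕ} {s : ℝ} {φ : Eucl N → ℝ} (hφ : IsTestFunction N φ)
    (hs0 : 0 < s) (hs1 : s < 1) (hN : 2 * s < (N : ℝ)) (p : Eucl N) :
    ENNReal.ofReal (gammaH N s) * hardyInt N s p φ ≤ energy N s φ := by
  have ht := isTestFunction_translate hφ p
  rw [← hardyInt_translate, ← energy_translate hφ.continuous.measurable p]
  exact hardy_of_lintegral_ne_top hs0 hs1 hN ht.continuous.measurable ht.lintegral_sq_ne_top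
    (ht.hardyInt_zero_ne_top hs0 hN)

theorem energy_le_of_sq_le {N : ℕ} {s A B : ℝ} (hA : 0 ≤ A) (hB : 0 ≤ B)
    {f g h : Eucl N → ℝ} (hf : AEMeasurable f)
    (hle : ∀ x y, (h x - h y) ^ 2 ≤ A * (f x - f y) ^ 2 + B * (g x - g y) ^ 2) :
    energy N s h ≤ ENNReal.ofReal A * energy N s f + ENNReal.ofReal B * energy N s g := by
  unfold energy
  rw [mul_left_comm, mul_left_comm (ENNReal.ofReal B), ← mul_add,
    ← lintegral_const_mul' (ENNReal.ofReal A) _ ENNReal.ofReal_ne_top,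
    ← lintegral_const_mul' (ENNReal.ofReal B) _ ENNReal.ofReal_ne_top, ← lintegral_add_left']
  · refine mul_le_mul_right (lintegral_mono fun z => ?_) _
    rw [← ENNReal.ofReal_mul hA, ← ENNReal.ofReal_mul hB,
      ← ENNReal.ofReal_add (by positivity) (by positivity), ← mul_div_assoc, ← mul_div_assoc,
      ← add_div]
    exact ENNReal.ofReal_le_ofReal
      (div_le_div_of_nonneg_right (hle _ _) (by positivity))
  · have h1 : AEMeasurable (fun z : Eucl N × Eucl N => f z.1) :=
      hf.comp_quasiMeasurePreserving Measure.quasiMeasurePreserving_fst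
    have h2 : AEMeasurable (fun z : Eucl N × Eucl N => f z.2) :=
      hf.comp_quasiMeasurePreserving Measure.quasiMeasurePreserving_snd
    have h3 : Measurable fun z : Eucl N × Eucl N => ‖z.1 - z.2‖ ^ ((N : ℝ) + 2 * s) := by fun_prop
    exact ((((h1.sub h2).pow_const 2).div h3.aemeasurable).ennreal_ofReal).const_mul _

theorem energy_ne_top_of_mem_Ds {N : ℕ} {s : ℝ} (hs0 : 0 < s) (hs1 : s < 1) (hN : 0 < N)
    {u : Eucl N → ℝ} (hu : u ∈ Ds N s) : energy N s u ≠ ∞ := by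
  obtain ⟨_, φ, hφ, hE, _⟩ := hu
  obtain ⟨n, hn⟩ := (hE.eventually_lt_const ENNReal.zero_lt_top).exists
  refine ne_top_of_le_ne_top ?_ (energy_le_of_sq_le (A := 2) (B := 2) zero_le_two zero_le_two
    (f := φ n) (g := φ n - u) (hφ n).continuous.measurable.aemeasurable fun x y => ?_)
  · exact ENNReal.add_ne_top.2 ⟨ENNReal.mul_ne_top ENNReal.ofReal_ne_top
      ((hφ n).energy_ne_top hs0 hs1 hN), ENNReal.mul_ne_top ENNReal.ofReal_ne_top hn.ne⟩
  · simp only [Pi.sub_apply]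
    nlinarith [sq_nonneg (2 * (φ n x - φ n y) - (u x - u y))]

theorem critExp_ne_zero {N : ℕ} {s : ℝ} (hs0 : 0 < s) (hN : 2 * s < (N : ℝ)) :
    critExp N s ≠ 0 := by
  unfold critExp
  have h1 : 0 < (N : ℝ) - 2 * s := by linarith
  have h2 : (0 : ℝ) < N := by linarith
  have : 0 < 2 * (N : ℝ) / ((N : ℝ) - 2 * s) := by positivity
  simpa using this

/-- The sharp fractional Hardy inequality. -/
theorem hardy_of_mem_Ds {N : ℕ} {s : ℝ} (hs0 : 0 < s) (hs1 : s < 1) (hN : 2 * s < (N : ℝ))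
    {u : Eucl N → ℝ} (hu : u ∈ Ds N s) (p : Eucl N) :
    ENNReal.ofReal (gammaH N s) * hardyInt N s p u ≤ energy N s u := by
  have hN0 : 0 < N := by
    have : (0 : ℝ) < N := by linarith
    exact_mod_cast this
  have hfin := energy_ne_top_of_mem_Ds hs0 hs1 hN0 hu
  obtain ⟨hmem, φ, hφ, hE, hLp⟩ := hu
  obtain ⟨ns, hns, hae⟩ := (tendstoInMeasure_of_tendsto_eLpNorm (critExp_ne_zero hs0 hN)
    (fun n => (hφ n).continuous.aestronglyMeasurable) hmem.1 hLp).exists_seq_tendsto_ae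
  have hum : AEMeasurable u := hmem.1.aemeasurable
  have step : ∀ η : ℝ, 0 < η → ENNReal.ofReal (gammaH N s) * hardyInt N s p u ≤
      ENNReal.ofReal (1 + η) * energy N s u := by
    intro η hη
    have hlim : Tendsto (fun n => ENNReal.ofReal (1 + η) * energy N s u +
        ENNReal.ofReal (1 + η⁻¹) * energy N s (φ (ns n) - u)) atTop
        (𝓝 (ENNReal.ofReal (1 + η) * energy N s u + ENNReal.ofReal (1 + η⁻¹) * 0)) :=
      tendsto_const_nhds.add (ENNReal.Tendsto.const_mul (hE.comp hns.tendsto_atTop)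
        (Or.inr ENNReal.ofReal_ne_top))
    rw [mul_zero, add_zero] at hlim
    have hF := hardyInt_le_liminf (s := s) hN0 (tendsto_const_nhds (x := p))
      (fun n => (hφ (ns n)).continuous.measurable) hae
    calc _ ≤ ENNReal.ofReal (gammaH N s) *
          liminf (fun n => hardyInt N s p (φ (ns n))) atTop := by gcongr
      _ = liminf (fun n => ENNReal.ofReal (gammaH N s) * hardyInt N s p (φ (ns n))) atTop :=
          (ENNReal.liminf_const_mul_of_ne_top ENNReal.ofReal_ne_top).symm
      _ ≤ liminf (fun n => ENNReal.ofReal (1 + η) * energy N s u +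
            ENNReal.ofReal (1 + η⁻¹) * energy N s (φ (ns n) - u)) atTop := by
          refine liminf_le_liminf (Eventually.of_forall fun n => ?_)
          refine ((hφ (ns n)).hardy hs0 hs1 hN p).trans
            (energy_le_of_sq_le (by positivity) (by positivity) hum fun x y => ?_)
          simp only [Pi.sub_apply]
          set A := u x - u y
          set B := φ (ns n) x - u x - (φ (ns n) y - u y)
          have hAB : φ (ns n) x - φ (ns n) y = A + B := by simp only [A, B]; ring
          rw [hAB]
          have : (1 + η) * A ^ 2 + (1 + η⁻¹) * B ^ 2 - (A + B) ^ 2 =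
              (η * A - B) ^ 2 * η⁻¹ := by field_simp; ring
          have : 0 ≤ (η * A - B) ^ 2 * η⁻¹ := by positivity
          linarith
      _ = _ := hlim.liminf_eq
  have hlim : Tendsto (fun η : ℝ => ENNReal.ofReal (1 + η) * energy N s u) (𝓝[>] 0)
      (𝓝 (ENNReal.ofReal (1 + 0) * energy N s u)) := by
    refine ENNReal.Tendsto.mul_const (ENNReal.tendsto_ofReal ?_) (Or.inr hfin)
    exact (Continuous.tendsto (by fun_prop) (0 : ℝ)).mono_left nhdsWithin_le_nhds
  rw [add_zero, ENNReal.ofReal_one, one_mul] at hlim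
  exact ge_of_tendsto hlim (eventually_mem_nhdsWithin.mono fun η hη => step η hη)

theorem IsTestFunction.mem_Ds {N : ℕ} {s : ℝ} {φ : Eucl N → ℝ} (hφ : IsTestFunction N φ) :
    φ ∈ Ds N s := by
  refine ⟨hφ.continuous.memLp_of_hasCompactSupport hφ.2, fun _ => φ, fun _ => hφ, ?_, ?_⟩
  · simp [energy]
  · simp

theorem integral_eq_toReal_hardyInt {N : ℕ} {s : ℝ} {u : Eucl N → ℝ} (hu : AEMeasurable u)
    (p : Eucl N) :
    ∫ x, (u x) ^ 2 / ‖x - p‖ ^ (2 * s) = (hardyInt N s p u).toReal := by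
  have h2 : Measurable fun x : Eucl N => ‖x - p‖ ^ (2 * s) := by fun_prop
  have h3 : AEStronglyMeasurable (fun x => u x ^ 2 / ‖x - p‖ ^ (2 * s)) :=
    ((hu.pow_const 2).div h2.aemeasurable).aestronglyMeasurable
  rw [integral_eq_lintegral_of_nonneg_ae (ae_of_all _ fun x => by dsimp; positivity) h3]
  congr 1
  refine lintegral_congr fun x => ?_
  rw [← ENNReal.ofReal_mul (sq_nonneg _), mul_one_div]

theorem normSq_pos_of_mem_Ds {N : ℕ} {s : ℝ} (hs0 : 0 < s) (hs1 : s < 1)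
    (hN : 2 * s < (N : ℝ)) {u : Eucl N → ℝ} (hu : u ∈ Ds N s) (hne : ¬ u =ᵐ[volume] 0) :
    0 < normSq N s u := by
  have hN0 : 0 < N := by
    have : (0 : ℝ) < N := by linarith
    exact_mod_cast this
  refine ENNReal.toReal_pos (fun h0 => hne ?_) (energy_ne_top_of_mem_Ds hs0 hs1 hN0 hu)
  have h1 := hardy_of_mem_Ds hs0 hs1 hN hu 0
  have h2 : 0 < ENNReal.ofReal (gammaH N s) := ENNReal.ofReal_pos.2 (gammaH_pos hs0 hN)
  rw [h0, nonpos_iff_eq_zero, mul_eq_zero, or_iff_right h2.ne'] at h1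
  have hum : AEMeasurable u := hu.1.1.aemeasurable
  have h3 : Measurable fun x : Eucl N => ENNReal.ofReal (1 / ‖x - 0‖ ^ (2 * s)) := by fun_prop
  replace h1 := (lintegral_eq_zero_iff' ((hum.pow_const 2).ennreal_ofReal.mul h3.aemeasurable)).1 h1
  filter_upwards [h1, ae_ne_zero hN0] with x hx hx0
  have hx' : 0 < ‖x - 0‖ := by rw [sub_zero]; exact norm_pos_iff.2 hx0
  have h4 : 0 < 1 / ‖x - 0‖ ^ (2 * s) := by positivity
  simp only [Pi.mul_apply, Pi.zero_apply, mul_eq_zero, ENNReal.ofReal_eq_zero,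
    or_iff_left (not_le.2 h4)] at hx ⊢
  exact pow_eq_zero_iff two_ne_zero |>.1 (le_antisymm hx (sq_nonneg _))

theorem gammaH_mul_toReal_hardyInt_le {N : ℕ} {s : ℝ} (hs0 : 0 < s) (hs1 : s < 1)
    (hN : 2 * s < (N : ℝ)) {u : Eucl N → ℝ} (hu : u ∈ Ds N s) (p : Eucl N) :
    gammaH N s * (hardyInt N s p u).toReal ≤ normSq N s u := by
  have hN0 : 0 < N := by
    have : (0 : ℝ) < N := by linarith
    exact_mod_cast this
  have h := ENNReal.toReal_mono (energy_ne_top_of_mem_Ds hs0 hs1 hN0 hu)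
    (hardy_of_mem_Ds hs0 hs1 hN hu p)
  rwa [ENNReal.toReal_mul, ENNReal.toReal_ofReal (gammaH_pos hs0 hN).le] at h

theorem exists_isTestFunction_energy_lt {N : ℕ} {s L : ℝ} (hs0 : 0 < s) (hs1 : s < 1)
    (hN : 2 * s < (N : ℝ)) (hL : gammaH N s < L) :
    ∃ φ, IsTestFunction N φ ∧ normSq N s φ < L * (hardyInt N s 0 φ).toReal := by
  have hN0 : 0 < N := by
    have : (0 : ℝ) < N := by linarith
    exact_mod_cast this
  have hL0 := (gammaH_pos hs0 hN).trans hL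
  obtain ⟨q, hq, hlt⟩ := exists_bubble_energy_lt hs0 hs1 hN hL
  have hδ : ∀ n : ℕ, 0 < 1 / ((n : ℝ) + 1) := fun n => by positivity
  have htest : ∀ n : ℕ, IsTestFunction N (truncBubble q (1 / ((n : ℝ) + 1))) :=
    fun n => isTestFunction_truncBubble hq (hδ n)
  have hF := hardyInt_le_liminf (s := s) hN0 (tendsto_const_nhds (x := (0 : Eucl N)))
    (fun n => (htest n).continuous.measurable) (ae_of_all _ (tendsto_truncBubble q))
  have h1 : energy N s (bubble q) < liminf (fun n : ℕ => ENNReal.ofReal L *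
      hardyInt N s 0 (truncBubble (N := N) q (1 / ((n : ℝ) + 1)))) atTop := by
    rw [ENNReal.liminf_const_mul_of_ne_top ENNReal.ofReal_ne_top]
    exact hlt.trans_le (by gcongr)
  obtain ⟨n, hn⟩ := (eventually_lt_of_lt_liminf h1).exists
  refine ⟨_, htest n, ?_⟩
  have h2 := (energy_truncBubble_le (s := s) (q := q) (hδ n)).trans_lt hn
  have h3 := (ENNReal.toReal_lt_toReal ((htest n).energy_ne_top hs0 hs1 hN0)
    (ENNReal.mul_ne_top ENNReal.ofReal_ne_top ((htest n).hardyInt_ne_top hs0 hN 0))).2 h2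
  rwa [ENNReal.toReal_mul, ENNReal.toReal_ofReal hL0.le] at h3

/-! ### Displacing the poles -/

theorem IsTestFunction.tendsto_hardyInt_zero {N : ℕ} {s : ℝ} {φ : Eucl N → ℝ}
    (hφ : IsTestFunction N φ) (hs0 : 0 < s) {p : ℕ → Eucl N}
    (hp : Tendsto (fun n => ‖p n‖) atTop atTop) :
    Tendsto (fun n => hardyInt N s (p n) φ) atTop (𝓝 0) := by
  obtain ⟨R, hR, hsupp⟩ := hφ.exists_radius
  have h1 : Tendsto (fun n => (‖p n‖ - R) ^ (-(2 * s))) atTop (𝓝 0) :=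
    (tendsto_rpow_neg_atTop (by positivity)).comp (tendsto_atTop_add_const_right _ (-R) hp)
  have h2 : Tendsto (fun n => ENNReal.ofReal ((‖p n‖ - R) ^ (-(2 * s))) *
      ∫⁻ x, ENNReal.ofReal (φ x ^ 2)) atTop (𝓝 0) := by
    have := ENNReal.Tendsto.mul_const (b := ∫⁻ x, ENNReal.ofReal (φ x ^ 2))
      (ENNReal.tendsto_ofReal h1) (Or.inr hφ.lintegral_sq_ne_top)
    rwa [ENNReal.ofReal_zero, zero_mul] at this
  refine tendsto_of_tendsto_of_tendsto_of_le_of_le' tendsto_const_nhds h2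
    (Eventually.of_forall fun _ => bot_le) ?_
  filter_upwards [hp.eventually_gt_atTop R] with n hn
  unfold hardyInt
  rw [← lintegral_const_mul' _ _ ENNReal.ofReal_ne_top]
  refine lintegral_mono fun x => ?_
  by_cases hx : φ x = 0
  · simp [hx]
  · rw [mul_comm]
    gcongr
    have h3 : 0 < ‖p n‖ - R := by linarith
    have h4 : ‖p n‖ - R ≤ ‖x - p n‖ := by
      have := hsupp x hx
      have := norm_sub_norm_le (p n) x
      rw [norm_sub_rev] at this
      linarith
    rw [one_div, rpow_neg h3.le]
    gcongr

theorem IsTestFunction.eventually_lt_mul_hardyInt {N : ℕ} {s : ℝ} {φ : Eucl N → ℝ}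
    (hφ : IsTestFunction N φ) (hs0 : 0 < s) (hN : 2 * s < (N : ℝ)) {p : ℕ → Eucl N} {l η : ℝ}
    (hη : 0 < η) (hpos : 0 < l → Tendsto p atTop (𝓝 0))
    (hneg : l ≤ 0 → Tendsto (fun n => ‖p n‖) atTop atTop) :
    ∀ᶠ n in atTop, max 0 l * (hardyInt N s 0 φ).toReal - η <
      l * (hardyInt N s (p n) φ).toReal := by
  have hN0 : 0 < N := by
    have : (0 : ℝ) < N := by linarith
    exact_mod_cast this
  rcases lt_or_ge 0 l with hl | hl
  · rw [max_eq_right hl.le]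
    have hF := hardyInt_le_liminf (s := s) hN0 (hpos hl) (fun _ => hφ.continuous.measurable)
      (ae_of_all _ fun x => tendsto_const_nhds (x := φ x))
    have h1 : ∀ᶠ n in atTop, (hardyInt N s 0 φ).toReal - η / l <
        (hardyInt N s (p n) φ).toReal := by
      rcases lt_or_ge ((hardyInt N s 0 φ).toReal - η / l) 0 with h | h
      · exact Eventually.of_forall fun n => h.trans_le ENNReal.toReal_nonneg
      · have h2 : ENNReal.ofReal ((hardyInt N s 0 φ).toReal - η / l) < hardyInt N s 0 φ := by
          rw [ENNReal.ofReal_lt_iff_lt_toReal h (hφ.hardyInt_ne_top hs0 hN 0)]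
          have : 0 < η / l := by positivity
          linarith
        filter_upwards [eventually_lt_of_lt_liminf (h2.trans_le hF)] with n hn
        exact (ENNReal.ofReal_lt_iff_lt_toReal h (hφ.hardyInt_ne_top hs0 hN _)).1 hn
    filter_upwards [h1] with n hn
    have := mul_lt_mul_of_pos_left hn hl
    rwa [mul_sub, mul_div_cancel₀ _ hl.ne'] at this
  · rw [max_eq_left hl, zero_mul, zero_sub]
    have h1 := (ENNReal.tendsto_toReal ENNReal.zero_ne_top).comp
      (hφ.tendsto_hardyInt_zero hs0 (hneg hl))
    have h2 := h1.const_mul l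
    rw [ENNReal.toReal_zero, mul_zero] at h2
    exact h2.eventually_const_lt (by linarith)

/-- Coordinates of the displaced poles: those with positive mass approach the origin on one side,
the others escape to infinity on the other side. -/
def poleCoord (l : ℝ) (i n : ℕ) : ℝ :=
  if 0 < l then ((i : ℝ) + 1) * (1 / ((n : ℝ) + 1)) else -(((i : ℝ) + 1) * ((n : ℝ) + 1))

theorem poleCoord_injective {k : ℕ} (lam : Fin k → ℝ) (n : ℕ) :
    Function.Injective fun i : Fin k => poleCoord (lam i) i n := by
  intro i j hij
  have hn : (0 : ℝ) < (n : ℝ) + 1 := by positivity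
  have hn' : (0 : ℝ) < 1 / ((n : ℝ) + 1) := by positivity
  have hpos : ∀ m : ℕ, 0 < ((m : ℝ) + 1) * (1 / ((n : ℝ) + 1)) := fun m => by positivity
  have hpos' : ∀ m : ℕ, 0 < ((m : ℝ) + 1) * ((n : ℝ) + 1) := fun m => by positivity
  unfold poleCoord at hij
  dsimp only at hij
  apply Fin.ext
  split_ifs at hij
  · have := mul_right_cancel₀ hn'.ne' hij
    exact_mod_cast add_right_cancel this
  · linarith [hpos i, hpos' j]
  · linarith [hpos j, hpos' i]
  · have := mul_right_cancel₀ hn.ne' (neg_injective hij)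
    exact_mod_cast add_right_cancel this

theorem exists_poles_Q_neg {N : ℕ} {s : ℝ} (hs0 : 0 < s) (hN : 2 * s < (N : ℝ)) {k : ℕ}
    (lam : Fin k → ℝ) {φ : Eucl N → ℝ} (hφ : IsTestFunction N φ)
    (hlt : normSq N s φ < (∑ i, max 0 (lam i)) * (hardyInt N s 0 φ).toReal) :
    ∃ a : Fin k → Eucl N, Function.Injective a ∧ Q N s lam a φ < 0 := by
  have hN0 : 0 < N := by
    have : (0 : ℝ) < N := by linarith
    exact_mod_cast this
  let e : Eucl N := EuclideanSpace.single ⟨0, hN0⟩ 1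
  have he : ‖e‖ = 1 := by simp [e]
  have he0 : e ≠ 0 := norm_pos_iff.1 (he ▸ one_pos)
  let a : ℕ → Fin k → Eucl N := fun n i => poleCoord (lam i) i n • e
  set h := (hardyInt N s 0 φ).toReal
  set η := ((∑ i, max 0 (lam i)) * h - normSq N s φ) / ((k : ℝ) + 1) with hη_def
  have hη : 0 < η := div_pos (sub_pos.2 hlt) (by positivity)
  have hev : ∀ᶠ n in atTop, ∀ i, max 0 (lam i) * h - η <
      lam i * (hardyInt N s (a n i) φ).toReal := by
    rw [eventually_all]
    intro i
    refine hφ.eventually_lt_mul_hardyInt hs0 hN hη (fun hl => ?_) fun hl => ?_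
    · have h1 := (tendsto_one_div_add_atTop_nhds_zero_nat (𝕜 := ℝ)).const_mul ((i : ℝ) + 1)
      have h2 := h1.smul_const e
      rw [mul_zero, zero_smul] at h2
      simpa only [a, poleCoord, if_pos hl] using h2
    · have h1 : ∀ n : ℕ, ‖a n i‖ = ((i : ℝ) + 1) * ((n : ℝ) + 1) := fun n => by
        simp only [a, poleCoord, if_neg (not_lt.2 hl)]
        rw [norm_smul, he, mul_one, norm_neg, norm_eq_abs, abs_of_pos (by positivity)]
      simp_rw [h1]
      exact Tendsto.const_mul_atTop (by positivity)
        (tendsto_atTop_add_const_right _ _ tendsto_natCast_atTop_atTop)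
  obtain ⟨n, hn⟩ := hev.exists
  refine ⟨a n, fun i j hij => poleCoord_injective lam n (smul_left_injective ℝ he0 hij), ?_⟩
  have hsum : ∑ i, (max 0 (lam i) * h - η) ≤
      ∑ i, lam i * (hardyInt N s (a n i) φ).toReal := Finset.sum_le_sum fun i _ => (hn i).le
  rw [Finset.sum_sub_distrib, ← Finset.sum_mul, Finset.sum_const, Finset.card_univ,
    Fintype.card_fin, nsmul_eq_mul] at hsum
  unfold Q
  simp_rw [integral_eq_toReal_hardyInt hφ.continuous.measurable.aemeasurable]
  have hη2 : η * ((k : ℝ) + 1) = (∑ i, max 0 (lam i)) * h - normSq N s φ :=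
    div_mul_cancel₀ _ (by positivity)
  linarith

theorem not_ae_eq_zero_of_normSq_lt {N : ℕ} {s L : ℝ} {u : Eucl N → ℝ}
    (hlt : normSq N s u < L * (hardyInt N s 0 u).toReal) : ¬ u =ᵐ[volume] 0 := by
  intro h0
  have : hardyInt N s 0 u = 0 := by
    unfold hardyInt
    rw [← lintegral_zero (α := Eucl N) (μ := volume)]
    refine lintegral_congr_ae ?_
    filter_upwards [h0] with x hx
    simp [hx]
  rw [this, ENNReal.toReal_zero, mul_zero] at hlt
  exact absurd hlt (not_lt.2 ENNReal.toReal_nonneg)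

theorem isPosDef_of_sum_lt {N : ℕ} {s : ℝ} (hs0 : 0 < s) (hs1 : s < 1) (hN : 2 * s < (N : ℝ))
    {k : ℕ} {lam : Fin k → ℝ} (hlam : ∑ i, max 0 (lam i) < gammaH N s) (a : Fin k → Eucl N) :
    IsPosDef N s lam a := by
  have hγ := gammaH_pos hs0 hN
  obtain ⟨φ, hφ, hlt⟩ := exists_isTestFunction_energy_lt hs0 hs1 hN (lt_add_one (gammaH N s))
  have hc : 0 < 1 - (∑ i, max 0 (lam i)) / gammaH N s := by
    rw [sub_pos, div_lt_one hγ]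
    exact hlam
  refine hc.trans_le (le_csInf ⟨_, φ, hφ.mem_Ds, not_ae_eq_zero_of_normSq_lt hlt, rfl⟩ ?_)
  rintro t ⟨u, hu, hu0, rfl⟩
  have hE := normSq_pos_of_mem_Ds hs0 hs1 hN hu hu0
  rw [le_div_iff₀ hE]
  unfold Q
  simp_rw [integral_eq_toReal_hardyInt (s := s) hu.1.1.aemeasurable]
  have hsum : ∑ i, lam i * (hardyInt N s (a i) u).toReal ≤
      ∑ i, max 0 (lam i) * (normSq N s u / gammaH N s) := by
    refine Finset.sum_le_sum fun i _ => ?_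
    have h1 := gammaH_mul_toReal_hardyInt_le hs0 hs1 hN hu (a i)
    have h2 : (hardyInt N s (a i) u).toReal ≤ normSq N s u / gammaH N s := by
      rw [le_div_iff₀ hγ]
      linarith
    exact mul_le_mul (le_max_right _ _) h2 ENNReal.toReal_nonneg (le_max_left _ _)
  rw [← Finset.sum_mul] at hsum
  have : (∑ i, max 0 (lam i)) * (normSq N s u / gammaH N s) =
      (∑ i, max 0 (lam i)) / gammaH N s * normSq N s u := by ring
  linarith

theorem not_isPosDef_of_Q_neg {N : ℕ} {s : ℝ} (hs0 : 0 < s) (hs1 : s < 1)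
    (hN : 2 * s < (N : ℝ)) {k : ℕ} {lam : Fin k → ℝ} {a : Fin k → Eucl N} {u : Eucl N → ℝ}
    (hu : u ∈ Ds N s) (hu0 : ¬ u =ᵐ[volume] 0) (hQ : Q N s lam a u < 0) :
    ¬ IsPosDef N s lam a := by
  have hE := normSq_pos_of_mem_Ds hs0 hs1 hN hu hu0
  refine not_lt.2 (Real.sInf_nonpos' ⟨_, ⟨u, hu, hu0, rfl⟩, (div_neg_of_neg_of_pos hQ hE).le⟩)

end FracHardy

end

theorem theorem1p4 (N : ℕ) (s : ℝ) (hs0 : 0 < s) (hs1 : s < 1) (hN : 2 * s < (N : ℝ))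
    (k : ℕ) (hk : 1 ≤ k) (lam : Fin k → ℝ) :
    ((∑ i, max 0 (lam i) < FracHardy.gammaH N s) →
      ∀ a : Fin k → EuclideanSpace ℝ (Fin N), FracHardy.IsPosDef N s lam a) ∧
    ((FracHardy.gammaH N s < ∑ i, max 0 (lam i)) →
      ∃ a : Fin k → EuclideanSpace ℝ (Fin N),
        Function.Injective a ∧ ¬ FracHardy.IsPosDef N s lam a) := by
  refine ⟨fun h a => FracHardy.isPosDef_of_sum_lt hs0 hs1 hN h a, fun h => ?_⟩
  obtain ⟨φ, hφ, hlt⟩ := FracHardy.exists_isTestFunction_energy_lt hs0 hs1 hN h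
  obtain ⟨a, ha, hQ⟩ := FracHardy.exists_poles_Q_neg hs0 hN lam hφ hlt
  exact ⟨a, ha, FracHardy.not_isPosDef_of_Q_neg hs0 hs1 hN hφ.mem_Ds
    (FracHardy.not_ae_eq_zero_of_normSq_lt hlt) hQ⟩
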